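/- Let $F$ be a field, let $1\le k\le n$ be integers, let $\mathbf P^1=\operatorname{Proj}F[x_0,x_1]$ with $U_i=D(x_i)$, $t=x_1/x_0$ on $U_0$ and $s=x_0/x_1=t^{-1}$ on $U_1$, and let $\mathcal O=\mathcal O_{\mathbf P^1}$. Let $\mathcal I$ be the ideal sheaf of the diagonal in $\mathbf P^1\times_F\mathbf P^1$, let $X^k$ be the closed subscheme defined by $\mathcal I^{k+1}$, with projections $p,q:X^k\to\mathbf P^1$, and let $\mathcal P^k(\mathcal O(n))=p_*q^*\mathcal O(n)$ be the module of principal parts, with the left $\mathcal O$-module structure given by $p$. Put $dt=q^\sharp t-p^\sharp t$, $ds=q^\sharp s-p^\sharp s$, $dt^l\otimes x_0^n=(dt)^l\,q^*(x_0^n)$ over $U_0$ and $ds^j\otimes x_1^n=(ds)^j\,q^*(x_1^n)$ over $U_1$. For $1\le r\le k$ let $A_r$ be the $(r+1)\times(r+1)$ integer matrix whose entry in row $i$ and column $j$ ($0\le i,j\le r$) is $(-1)^j\binom{n-j}{k-i-j}$ (which is $0$ if $k-i-j<0$), and let $b_r=(0,\dots,0,1)\in\mathbf Z^{r+1}$.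 (1) Let $1\le r\le k$ and let $\mathbf x_r=(x_{0,r},\dots,x_{r,r})\in F^{r+1}$ be a solution of $A_r\mathbf x_r=b_r$. Then there is exactly one map of left $\mathcal O$-modules $\phi_r:\mathcal O(n-k)\to\mathcal P^k(\mathcal O(n))$ such that $$\phi_r(x_0^{n-k})=\sum_{l=0}^{k-r}c^r_l\,t^{k-r-l}\,dt^l\otimes x_0^n\ \text{ on }U_0,\qquad \phi_r(x_1^{n-k})=\sum_{j=0}^r x_{j,r}\,t^{j-r}\,ds^j\otimes x_1^n\ \text{ on }U_1,$$ where $c^r_l=\sum_{j=0}^r(-1)^j\binom{n-j}{l-j}x_{j,r}$, and $\phi_r\ne0$. For $r=0$ and $x_{0,0}=1$ (without any condition) the same formulas also define exactly one map $\phi_0:\mathcal O(n-k)\to\mathcal P^k(\mathcal O(n))$ of left $\mathcal O$-modules, and $\phi_0\neq 0$. (2) Put $x_{0,0}=1$, and let $\mathbf x_r\in F^{r+1}$ be a solution of $A_r\mathbf x_r=b_r$ for every $r=1,\dots,k$. If $\prod_{i=0}^k x_{i,i}\ne0$, then the map $$\phi=\oplus_{r=0}^k\phi_r:\ \bigoplus_{r=0}^k\mathcal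 O(n-k)\longrightarrow\mathcal P^k(\mathcal O(n))$$ given by the maps of (1) is an isomorphism of left $\mathcal O$-modules. -/

import Mathlib

open AlgebraicGeometry CategoryTheory CategoryTheory.Limits

universe u

noncomputable section

namespace PrincipalParts

/-! ### Principal parts of a module on a separated scheme -/

section General

variable {X S : Scheme.{u}} (f : X ⟶ S)

/-- The `k`-th order infinitesimal neighbourhood of the diagonal of `X` over `S`: the closed
subscheme of `X ×_S X` cut out by `I ^ (k + 1)`, where `I` is the ideal sheaf of the diagonal. -/
abbrev infNhd (k : ℕ) : Scheme.{u} :=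
  ((pullback.diagonal f).ker ^ (k + 1)).subscheme

/-- The first projection `p` from the infinitesimal neighbourhood to `X`. -/
def projLeft (k : ℕ) : infNhd f k ⟶ X :=
  ((pullback.diagonal f).ker ^ (k + 1)).subschemeι ≫ pullback.fst f f

/-- The second projection `q` from the infinitesimal neighbourhood to `X`. -/
def projRight (k : ℕ) : infNhd f k ⟶ X :=
  ((pullback.diagonal f).ker ^ (k + 1)).subschemeι ≫ pullback.snd f f

/-- The `k`-th order module of principal parts `p_* q^* E` of the `𝒪_X`-module `E` over `S`, with
its left `𝒪_X`-module structure, the one given by the first projection `p`. -/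
def principalParts (k : ℕ) (E : X.Modules) : X.Modules :=
  (Scheme.Modules.pushforward (projLeft f k)).obj
    ((Scheme.Modules.pullback (projRight f k)).obj E)

/-- The two projections agree on points, as the infinitesimal neighbourhood is supported on the
diagonal. -/
theorem projLeft_apply_eq [IsSeparated f] (k : ℕ) (z : infNhd f k) :
    projLeft f k z = projRight f k z := by
  have h1 : ((pullback.diagonal f).ker ^ (k + 1)).subschemeι z ∈
      Set.range (pullback.diagonal f) := by
    have h2 := Set.mem_range_self (f := ((pullback.diagonal f).ker ^ (k + 1)).subschemeι) z
    rw [Scheme.IdealSheafData.range_subschemeι, Scheme.IdealSheafData.support_pow_succ,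
      Scheme.Hom.support_ker,
      (Scheme.Hom.isClosedEmbedding (pullback.diagonal f)).isClosed_range.closure_eq] at h2
    exact h2
  obtain ⟨x, hx⟩ := h1
  have hl : pullback.fst f f (pullback.diagonal f x) = x := by
    rw [← Scheme.Hom.comp_apply, pullback.diagonal_fst]; rfl
  have hr : pullback.snd f f (pullback.diagonal f x) = x := by
    rw [← Scheme.Hom.comp_apply, pullback.diagonal_snd]; rfl
  rw [projLeft, projRight, Scheme.Hom.comp_apply, Scheme.Hom.comp_apply, ← hx, hl, hr]

theorem projLeft_preimage_le [IsSeparated f] (k : ℕ) (U : X.Opens) :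
    projLeft f k ⁻¹ᵁ U ≤ projRight f k ⁻¹ᵁ U := by
  intro z hz
  have h : projLeft f k z ∈ U := hz
  rw [projLeft_apply_eq] at h
  exact h

variable [IsSeparated f] (k : ℕ) {U : X.Opens}

/-- For a function `a` on `U`, the function `da = q^♯ a - p^♯ a` on the infinitesimal
neighbourhood of the diagonal over `U`. If `a = t`, this is `dt = u - t`, where `t` stands for the
coordinate on the first factor and `u` for the same coordinate on the second factor. -/
def diffSec (a : Γ(X, U)) : Γ(infNhd f k, projLeft f k ⁻¹ᵁ U) :=
  ((infNhd f k).presheaf.map (homOfLE (projLeft_preimage_le f k U)).op).hom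
      (((projRight f k).app U).hom a) -
    ((projLeft f k).app U).hom a

/-- For a section `e` of `E` over `U`, the section `1 ⊗ e = q^* e` of `q^* E`. -/
def rightSec (E : X.Modules) (e : Γ(E, U)) :
    Γ((Scheme.Modules.pullback (projRight f k)).obj E, projLeft f k ⁻¹ᵁ U) :=
  (((Scheme.Modules.pullback (projRight f k)).obj E).presheaf.map
      (homOfLE (projLeft_preimage_le f k U)).op).hom
    ((((Scheme.Modules.pullbackPushforwardAdjunction (projRight f k)).unit.app E).app U).hom e)

/-- The section `(da) ^ l ⊗ e` over `U` of the principal parts of `E`. -/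
def diffPowTensor (E : X.Modules) (l : ℕ) (a : Γ(X, U)) (e : Γ(E, U)) :
    Γ(principalParts f k E, U) :=
  ((diffSec f k a ^ l • rightSec f k E e :
    Γ((Scheme.Modules.pullback (projRight f k)).obj E, projLeft f k ⁻¹ᵁ U)))

end General

/-! ### The module glued from two copies of the structure sheaf -/

section Glue

variable {X : Scheme.{u}}

/-- Restriction of functions. -/
abbrev res {U V : X.Opens} (h : U ≤ V) : Γ(X, V) →+* Γ(X, U) :=
  (X.presheaf.map (homOfLE h).op).hom

theorem res_res {U V W : X.Opens} (h : U ≤ V) (h' : V ≤ W) (a : Γ(X, W)) :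
    res h (res h' a) = res (h.trans h') a := by
  have : X.presheaf.map (homOfLE (h.trans h')).op =
      X.presheaf.map (homOfLE h').op ≫ X.presheaf.map (homOfLE h).op := by
    rw [← X.presheaf.map_comp]; rfl
  simp only [res]
  rw [this]; rfl

variable (V₀ V₁ : X.Opens) (g : Γ(X, V₀ ⊓ V₁))

/-- Sections over `U` of the module with transition function `g`: the pairs `(a₀, a₁)` of functions
on `U ∩ V₀` and on `U ∩ V₁` such that `a₀ = g * a₁` on `U ∩ V₀ ∩ V₁`. -/
def glueSec (U : X.Opens) : AddSubgroup (Γ(X, U ⊓ V₀) × Γ(X, U ⊓ V₁)) where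
  carrier := {a | res (inf_le_inf_left U inf_le_left) a.1 =
    res (inf_le_right : U ⊓ (V₀ ⊓ V₁) ≤ V₀ ⊓ V₁) g * res (inf_le_inf_left U inf_le_right) a.2}
  add_mem' {a b} ha hb := by
    simp only [Set.mem_ofPred_eq, Prod.fst_add, Prod.snd_add, map_add] at ha hb ⊢
    rw [ha, hb, mul_add]
  zero_mem' := by simp
  neg_mem' {a} ha := by
    simp only [Set.mem_ofPred_eq, Prod.fst_neg, Prod.snd_neg, map_neg] at ha ⊢
    rw [ha, mul_neg]

theorem glueSec_ext {U : X.Opens} {a b : glueSec V₀ V₁ g U} (h₀ : a.1.1 = b.1.1)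
    (h₁ : a.1.2 = b.1.2) : a = b := Subtype.ext (Prod.ext h₀ h₁)

instance (U : X.Opens) : SMul Γ(X, U) (glueSec V₀ V₁ g U) where
  smul r a := ⟨(res inf_le_left r * a.1.1, res inf_le_left r * a.1.2), by
    have ha : res (inf_le_inf_left U inf_le_left) a.1.1 =
      res (inf_le_right : U ⊓ (V₀ ⊓ V₁) ≤ V₀ ⊓ V₁) g *
        res (inf_le_inf_left U inf_le_right) a.1.2 := a.2
    change res (inf_le_inf_left U inf_le_left) (res inf_le_left r * a.1.1) =
      res (inf_le_right : U ⊓ (V₀ ⊓ V₁) ≤ V₀ ⊓ V₁) g *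
        res (inf_le_inf_left U inf_le_right) (res inf_le_left r * a.1.2)
    rw [map_mul, map_mul, res_res, res_res, ha]
    ring⟩

theorem glueSec_smul_fst {U : X.Opens} (r : Γ(X, U)) (a : glueSec V₀ V₁ g U) :
    (r • a).1.1 = res inf_le_left r * a.1.1 := rfl

theorem glueSec_smul_snd {U : X.Opens} (r : Γ(X, U)) (a : glueSec V₀ V₁ g U) :
    (r • a).1.2 = res inf_le_left r * a.1.2 := rfl

instance (U : X.Opens) : Module Γ(X, U) (glueSec V₀ V₁ g U) where
  one_smul a := by
    apply glueSec_ext <;> simp [glueSec_smul_fst, glueSec_smul_snd]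
  mul_smul r s a := by
    apply glueSec_ext <;> simp [glueSec_smul_fst, glueSec_smul_snd, mul_assoc]
  smul_zero r := by
    apply glueSec_ext <;> simp [glueSec_smul_fst, glueSec_smul_snd]
  smul_add r a b := by
    apply glueSec_ext <;> simp [glueSec_smul_fst, glueSec_smul_snd, mul_add]
  add_smul r s a := by
    apply glueSec_ext <;> simp [glueSec_smul_fst, glueSec_smul_snd, add_mul]
  zero_smul a := by
    apply glueSec_ext <;> simp [glueSec_smul_fst, glueSec_smul_snd]

/-- Restriction of sections of the glued module. -/
def glueRes {U U' : X.Opens} (h : U ≤ U') : glueSec V₀ V₁ g U' →+ glueSec V₀ V₁ g U where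
  toFun a := ⟨(res (inf_le_inf_right V₀ h) a.1.1, res (inf_le_inf_right V₁ h) a.1.2), by
    have ha : res (inf_le_inf_left U' inf_le_left) a.1.1 =
      res (inf_le_right : U' ⊓ (V₀ ⊓ V₁) ≤ V₀ ⊓ V₁) g *
        res (inf_le_inf_left U' inf_le_right) a.1.2 := a.2
    have hb := congrArg (res (inf_le_inf_right (V₀ ⊓ V₁) h)) ha
    rw [map_mul, res_res, res_res, res_res] at hb
    change res (inf_le_inf_left U inf_le_left) (res (inf_le_inf_right V₀ h) a.1.1) =
      res (inf_le_right : U ⊓ (V₀ ⊓ V₁) ≤ V₀ ⊓ V₁) g *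
        res (inf_le_inf_left U inf_le_right) (res (inf_le_inf_right V₁ h) a.1.2)
    rw [res_res, res_res]
    exact hb⟩
  map_zero' := by apply glueSec_ext <;> simp
  map_add' a b := by apply glueSec_ext <;> simp

/-- The presheaf of abelian groups underlying the glued module. -/
def gluePresheaf : TopCat.Presheaf Ab.{u} X where
  obj U := AddCommGrpCat.of (glueSec V₀ V₁ g U.unop)
  map i := AddCommGrpCat.ofHom (glueRes V₀ V₁ g i.unop.le)
  map_id U := by
    refine AddCommGrpCat.hom_ext (AddMonoidHom.ext fun a => ?_)
    apply glueSec_ext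
    · change (X.presheaf.map (𝟙 _)).hom _ = _
      simp
    · change (X.presheaf.map (𝟙 _)).hom _ = _
      simp
  map_comp i j := by
    refine AddCommGrpCat.hom_ext (AddMonoidHom.ext fun a => ?_)
    apply glueSec_ext
    · exact (res_res _ _ _).symm
    · exact (res_res _ _ _).symm

theorem gluePresheaf_isSheaf : (gluePresheaf V₀ V₁ g).IsSheaf := by
  rw [TopCat.Presheaf.isSheaf_iff_isSheaf_comp (forget Ab.{u})]
  apply TopCat.Presheaf.isSheaf_of_isSheafUniqueGluing_types
  intro ι U sf hsf
  let a : ∀ i, glueSec V₀ V₁ g (U i) := sf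
  have hc : ∀ i j, glueRes V₀ V₁ g inf_le_left (a i) =
      (glueRes V₀ V₁ g inf_le_right (a j) : glueSec V₀ V₁ g (U i ⊓ U j)) := hsf
  have hcov : ∀ W : X.Opens, iSup U ⊓ W ≤ ⨆ i, U i ⊓ W := fun W => (iSup_inf_eq U W).le
  have hle : ∀ (W : X.Opens) i, U i ⊓ W ≤ iSup U ⊓ W :=
    fun W i => inf_le_inf_right W (le_iSup U i)
  have hsub : ∀ (W : X.Opens) i j, (U i ⊓ W) ⊓ (U j ⊓ W) ≤ (U i ⊓ U j) ⊓ W :=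
    fun W i j => le_inf (inf_le_inf inf_le_left inf_le_left) (inf_le_left.trans inf_le_right)
  obtain ⟨(s₀ : Γ(X, iSup U ⊓ V₀)), hs₀, hu₀⟩ := X.sheaf.existsUnique_gluing' (fun i => U i ⊓ V₀) (iSup U ⊓ V₀)
    (fun i => homOfLE (hle V₀ i)) (hcov V₀) (fun i => (a i).1.1) (fun i j => by
      have h := congrArg (fun b => res (hsub V₀ i j) b.1.1) (hc i j)
      exact ((res_res _ _ _).symm.trans h).trans (res_res _ _ _))
  obtain ⟨(s₁ : Γ(X, iSup U ⊓ V₁)), hs₁, hu₁⟩ := X.sheaf.existsUnique_gluing' (fun i => U i ⊓ V₁) (iSup U ⊓ V₁)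
    (fun i => homOfLE (hle V₁ i)) (hcov V₁) (fun i => (a i).1.2) (fun i j => by
      have h := congrArg (fun b => res (hsub V₁ i j) b.1.2) (hc i j)
      exact ((res_res _ _ _).symm.trans h).trans (res_res _ _ _))
  have h₀ : ∀ i, res (hle V₀ i) s₀ = (a i).1.1 := hs₀
  have h₁ : ∀ i, res (hle V₁ i) s₁ = (a i).1.2 := hs₁
  have hmem : (s₀, s₁) ∈ glueSec V₀ V₁ g (iSup U) := by
    refine X.sheaf.eq_of_locally_eq' (fun i => U i ⊓ (V₀ ⊓ V₁)) (iSup U ⊓ (V₀ ⊓ V₁))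
      (fun i => homOfLE (hle _ i)) (hcov _) _ _ (fun i => ?_)
    have ha : res (inf_le_inf_left (U i) inf_le_left) (a i).1.1 =
      res (inf_le_right : U i ⊓ (V₀ ⊓ V₁) ≤ V₀ ⊓ V₁) g *
        res (inf_le_inf_left (U i) inf_le_right) (a i).1.2 := (a i).2
    change res (hle _ i) (res (inf_le_inf_left _ inf_le_left) s₀) =
      res (hle _ i) (res inf_le_right g * res (inf_le_inf_left _ inf_le_right) s₁)
    rw [← h₀, ← h₁, res_res, res_res] at ha
    rw [map_mul, res_res, res_res, res_res]
    exact ha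
  refine ⟨(⟨(s₀, s₁), hmem⟩ : glueSec V₀ V₁ g (iSup U)), fun i => ?_, fun s' hs' => ?_⟩
  · change glueRes V₀ V₁ g (le_iSup U i) ⟨(s₀, s₁), hmem⟩ = a i
    exact glueSec_ext V₀ V₁ g (h₀ i) (h₁ i)
  · let s : glueSec V₀ V₁ g (iSup U) := s'
    have hs : ∀ i, glueRes V₀ V₁ g (le_iSup U i) s = a i := hs'
    change s = _
    apply glueSec_ext
    · exact hu₀ _ fun i => congrArg (fun b => b.1.1) (hs i)
    · exact hu₁ _ fun i => congrArg (fun b => b.1.2) (hs i)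

instance gluePresheafModule (U : (TopologicalSpace.Opens X)ᵒᵖ) :
    Module (X.ringCatSheaf.obj.obj U) ((gluePresheaf V₀ V₁ g).obj U) :=
  inferInstanceAs (Module Γ(X, U.unop) (glueSec V₀ V₁ g U.unop))

/-- The `𝒪_X`-module obtained by gluing `𝒪_{V₀}` and `𝒪_{V₁}` along `V₀ ∩ V₁` by means of the
transition function `g`. It is invertible when `g` is a unit and `V₀`, `V₁` cover `X`. -/
def glueModule : X.Modules where
  val := PresheafOfModules.ofPresheaf (gluePresheaf V₀ V₁ g) (by
    intro U V i r m
    have h : ∀ (r : Γ(X, U.unop)) (m : glueSec V₀ V₁ g U.unop),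
        glueRes V₀ V₁ g i.unop.le (r • m) = res i.unop.le r • glueRes V₀ V₁ g i.unop.le m := by
      intro r m
      apply glueSec_ext
      · change res _ (res _ r * m.1.1) = res _ (res _ r) * res _ m.1.1
        rw [map_mul, res_res, res_res]
      · change res _ (res _ r * m.1.2) = res _ (res _ r) * res _ m.1.2
        rw [map_mul, res_res, res_res]
    exact h r m)
  isSheaf := gluePresheaf_isSheaf V₀ V₁ g

end Glue

/-! ### The projective line -/

section ProjectiveLine

variable (F : Type u) [Field F]

/-- The standard grading of `F[x₀, x₁]`. -/
abbrev gr : ℕ → Submodule F (MvPolynomial (Fin 2) F) := MvPolynomial.homogeneousSubmodule (Fin 2) F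

instance : GradedAlgebra (gr F) := MvPolynomial.gradedAlgebra

/-- The projective line `Proj F[x₀, x₁]`. -/
abbrev P1 : Scheme.{u} := Proj (gr F)

/-- The structure morphism of the projective line over `F`. -/
def P1.toSpec : P1 F ⟶ Spec (CommRingCat.of F) :=
  Proj.toSpecZero (gr F) ≫ Spec.map (CommRingCat.ofHom (algebraMap F (gr F 0)))

instance : IsSeparated (P1.toSpec F) := by
  unfold P1.toSpec; infer_instance

/-- The constant functions on an open set of the projective line. -/
def const (U : (P1 F).Opens) : F →+* Γ(P1 F, U) :=
  (((P1 F).presheaf.map (homOfLE le_top : U ⟶ ⊤).op).hom.comp (P1.toSpec F).appTop.hom).comp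
    (Scheme.ΓSpecIso (CommRingCat.of F)).inv.hom

theorem X_mem (i : Fin 2) : (MvPolynomial.X i : MvPolynomial (Fin 2) F) ∈ gr F 1 :=
  MvPolynomial.isHomogeneous_X F i

/-- The open set `U₀ = D(x₀)`. -/
abbrev U0 : (P1 F).Opens := Proj.basicOpen (gr F) (MvPolynomial.X 0)

/-- The open set `U₁ = D(x₁)`. -/
abbrev U1 : (P1 F).Opens := Proj.basicOpen (gr F) (MvPolynomial.X 1)

/-- The function `t = x₁ / x₀` on `U₀`. -/
def t : Γ(P1 F, U0 F) :=
  (Proj.awayToSection (gr F) (MvPolynomial.X 0)).hom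
    (HomogeneousLocalization.Away.mk (gr F) (X_mem F 0) 1 (MvPolynomial.X 1)
      (by simpa using X_mem F 1))

/-- The function `s = x₀ / x₁ = t⁻¹` on `U₁`. -/
def s : Γ(P1 F, U1 F) :=
  (Proj.awayToSection (gr F) (MvPolynomial.X 1)).hom
    (HomogeneousLocalization.Away.mk (gr F) (X_mem F 1) 1 (MvPolynomial.X 0)
      (by simpa using X_mem F 0))

theorem t_mul_s : res (inf_le_left : U0 F ⊓ U1 F ≤ U0 F) (t F) *
    res (inf_le_right : U0 F ⊓ U1 F ≤ U1 F) (s F) = 1 := by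
  have hx : (MvPolynomial.X 0 * MvPolynomial.X 1 : MvPolynomial (Fin 2) F) =
    MvPolynomial.X 1 * MvPolynomial.X 0 := mul_comm _ _
  have h := Proj.basicOpen_mul (gr F) (MvPolynomial.X 0) (MvPolynomial.X 1)
  have h₀ := CommRingCat.hom_ext_iff.mp
    (Proj.awayMap_awayToSection (gr F) (f := MvPolynomial.X 0) (X_mem F 1) rfl)
  have h₁ := CommRingCat.hom_ext_iff.mp
    (Proj.awayMap_awayToSection (gr F) (f := MvPolynomial.X 1) (X_mem F 0) hx)
  let t' := HomogeneousLocalization.Away.mk (gr F)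
    (X_mem F 0) 1 (MvPolynomial.X 1) (by simpa using X_mem F 1)
  let s' := HomogeneousLocalization.Away.mk (gr F)
    (X_mem F 1) 1 (MvPolynomial.X 0) (by simpa using X_mem F 0)
  let w := (Proj.awayToSection (gr F) (MvPolynomial.X 0 * MvPolynomial.X 1)).hom
  have e₀ : res h.ge (w (HomogeneousLocalization.awayMap (gr F) (X_mem F 1) rfl t')) =
      res (inf_le_left : U0 F ⊓ U1 F ≤ U0 F) (t F) :=
    (congrArg (res h.ge) (DFunLike.congr_fun h₀ t')).trans (res_res _ _ _)
  have e₁ : res h.ge (w (HomogeneousLocalization.awayMap (gr F) (X_mem F 0) hx s')) =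
      res (inf_le_right : U0 F ⊓ U1 F ≤ U1 F) (s F) :=
    (congrArg (res h.ge) (DFunLike.congr_fun h₁ s')).trans (res_res _ _ _)
  have e : HomogeneousLocalization.awayMap (gr F) (X_mem F 1) rfl t' *
      HomogeneousLocalization.awayMap (gr F) (X_mem F 0) hx s' = 1 := by
    ext
    rw [HomogeneousLocalization.val_mul, HomogeneousLocalization.val_one]
    simp only [t', s']
    rw [HomogeneousLocalization.awayMap_mk, HomogeneousLocalization.awayMap_mk,
      HomogeneousLocalization.Away.val_mk, HomogeneousLocalization.Away.val_mk,
      Localization.mk_mul, ← Localization.mk_one, Localization.mk_eq_mk_iff,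
      Localization.r_iff_exists]
    refine ⟨1, ?_⟩
    simp
    ring
  rw [← e₀, ← e₁, ← map_mul, ← map_mul, e, map_one, map_one]

theorem res_t_mul_s {U : (P1 F).Opens} (h₀ : U ≤ U0 F) (h₁ : U ≤ U1 F) :
    res h₀ (t F) * res h₁ (s F) = 1 := by
  have h := congrArg (res (le_inf h₀ h₁)) (t_mul_s F)
  rwa [map_mul, res_res, res_res, map_one] at h

/-- The invertible sheaf `𝒪(m)` on the projective line: it is free on `x₀ ^ m` over `U₀` and on
`x₁ ^ m` over `U₁`, and `x₁ ^ m = t ^ m x₀ ^ m` on `U₀ ∩ U₁`. The pair of functions `(a₀, a₁)`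
stands for the section which is `a₀ x₀ ^ m` on `U₀` and `a₁ x₁ ^ m` on `U₁`. -/
def twist (m : ℕ) : (P1 F).Modules :=
  glueModule (U0 F) (U1 F) (res inf_le_left (t F) ^ m)

/-- The section `x₀ ^ m` of `𝒪(m)` over `U₀`. -/
def x0Pow (m : ℕ) : Γ(twist F m, U0 F) :=
  (⟨(1, res inf_le_right (s F) ^ m), by
    change res (inf_le_inf_left _ inf_le_left) 1 =
      res (inf_le_right : U0 F ⊓ (U0 F ⊓ U1 F) ≤ _) (res inf_le_left (t F) ^ m) *
        res (inf_le_inf_left _ inf_le_right) (res inf_le_right (s F) ^ m)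
    rw [map_one, map_pow, map_pow, res_res, res_res, ← mul_pow, res_t_mul_s, one_pow]⟩ :
    glueSec (U0 F) (U1 F) (res inf_le_left (t F) ^ m) (U0 F))

/-- The section `x₁ ^ m` of `𝒪(m)` over `U₁`. -/
def x1Pow (m : ℕ) : Γ(twist F m, U1 F) :=
  (⟨(res inf_le_right (t F) ^ m, 1), by
    change res (inf_le_inf_left _ inf_le_left) (res inf_le_right (t F) ^ m) =
      res (inf_le_right : U1 F ⊓ (U0 F ⊓ U1 F) ≤ _) (res inf_le_left (t F) ^ m) *
        res (inf_le_inf_left _ inf_le_right) 1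
    rw [map_one, map_pow, map_pow, res_res, res_res, mul_one]⟩ :
    glueSec (U0 F) (U1 F) (res inf_le_left (t F) ^ m) (U1 F))

/-- The `k`-th order principal parts of `𝒪(n)` on the projective line over `F`, with the left
module structure. -/
def prin (k n : ℕ) : (P1 F).Modules := principalParts (P1.toSpec F) k (twist F n)

/-- The section `dt ^ l ⊗ x₀ ^ n` over `U₀`. -/
def dtPow (k n l : ℕ) : Γ(prin F k n, U0 F) :=
  diffPowTensor (P1.toSpec F) k (twist F n) l (t F) (x0Pow F n)

/-- The section `ds ^ j ⊗ x₁ ^ n` over `U₁`. -/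
def dsPow (k n j : ℕ) : Γ(prin F k n, U1 F) :=
  diffPowTensor (P1.toSpec F) k (twist F n) j (s F) (x1Pow F n)

end ProjectiveLine

/-! ### The linear systems and the maps given by their solutions -/

/-- The integer `(-1) ^ j * binom(n - j, l - j)`, which is `0` when `l < j`. -/
def coeff (n j l : ℕ) : ℤ := if j ≤ l then (-1) ^ j * ((n - j).choose (l - j) : ℤ) else 0

/-- The matrix `A_r`: its entry in row `i` and column `j`, for `0 ≤ i, j ≤ r`, is
`(-1) ^ j * binom(n - j, k - i - j)`. -/
def sysMatrix (n k r : ℕ) : Matrix (Fin (r + 1)) (Fin (r + 1)) ℤ :=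
  Matrix.of fun i j => coeff n j (k - i)

/-- The vector `b_r = (0, …, 0, 1)`. -/
def sysVector (r : ℕ) : Fin (r + 1) → ℤ := Pi.single (Fin.last r) 1

section Maps

variable (F : Type u) [Field F]

/-- The vector `x` with entries in `F` solves the system `A_r x = b_r`. -/
def IsSolution (n k r : ℕ) (x : Fin (r + 1) → F) : Prop :=
  ((sysMatrix n k r).map (Int.cast : ℤ → F)).mulVec x = fun i => (sysVector r i : F)

/-- The map `φ : 𝒪(n - k) ⟶ Pr^k(𝒪(n))` is given by the explicit formulas
`φ(x₀ ^ (n - k)) = ∑_{l = 0}^{k - r} c_l t ^ (k - r - l) dt ^ l ⊗ x₀ ^ n` on `U₀`, where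
`c_l = ∑_{j = 0}^r (-1) ^ j * binom(n - j, l - j) * x_j`, and
`φ(x₁ ^ (n - k)) = ∑_{j = 0}^r x_j t ^ (j - r) ds ^ j ⊗ x₁ ^ n` on `U₁`, where `t⁻¹ = s`. -/
def IsMapOf (n k r : ℕ) (x : Fin (r + 1) → F) (φ : twist F (n - k) ⟶ prin F k n) : Prop :=
  (φ.app (U0 F)).hom (x0Pow F (n - k)) =
      ∑ l ∈ Finset.range (k - r + 1),
        (const F (U0 F) (∑ j : Fin (r + 1), (coeff n j l : F) * x j) * t F ^ (k - r - l)) •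
          dtPow F k n l ∧
    (φ.app (U1 F)).hom (x1Pow F (n - k)) =
      ∑ j : Fin (r + 1), (const F (U1 F) (x j) * s F ^ (r - (j : ℕ))) • dsPow F k n j

end Maps

instance (X : Scheme.{u}) : HasFiniteBiproducts X.Modules := Abelian.hasFiniteBiproducts

end PrincipalParts

end

/-!
Write `V = U₀ ∩ U₁`. Over `U₀` the left module `𝒫^k(𝒪(n))` is free on `dt ^ l ⊗ x₀ ^ n`, and over
`U₁` it is free on `ds ^ l ⊗ x₁ ^ n`, where `0 ≤ l ≤ k`. Indeed, if `A` is a polynomial ring `R[a]`,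
then `A ⊗_R A = A[da]` with `da = 1 ⊗ a - a ⊗ 1`, the kernel of the multiplication is generated by
`da`, and so `A ⊗_R A` modulo its `(k + 1)`-st power is free on the powers of `da`
(`bijective_sum_pow_of_isPushout`). This passes to basic open subsets by localization
(`diffSec_pow_bijective_basicOpen`) and from functions to `𝒪(n)` because the pullback of a module
glued from two copies of the structure sheaf is glued in the same way
(`exists_isIso_glueModule_pullback`).

A morphism from `𝒪(n - k)` is the same as a pair of sections `e₀` over `U₀` and `e₁` over `U₁` with
`e₁ = t ^ (n - k) e₀` on `V` (`glueModule_hom_ext`, `exists_glueModule_hom`). For the two sums in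
the definition of `φ_r` this condition is an identity in the functions on the infinitesimal
neighbourhood of the diagonal over `V` (`sum_change_of_coordinates`). There, with `T = p^♯ t` and
`D = dt`, one has `T (T + D) ds = -D`. Hence `T ^ r` times the sum over `U₁` is
`∑_j x_j (-D) ^ j (T + D) ^ (n - j)`, which the binomial theorem turns into
`∑_l c_l D ^ l T ^ (n - l)`, where `c_l` is `diffCoeff n x l`. The terms with `l > k` vanish since
`D ^ (k + 1) = 0`. The equations `A_r x = b_r` say that `c_l = 0` for `k - r < l ≤ k` and that
`c_{k - r} = 1` (`IsSolution.diffCoeff_eq`), so the powers of `T` that remain can be divided out.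

The maps are nonzero because the coefficient `c_{k - r}` of a basis element over `U₀` (or, for
`r = 0`, the coefficient `x_{0, 0}` of a basis element over `U₁`) is.

Being an isomorphism can be tested on the basic open subsets of `U₀` and of `U₁`
(`isIso_of_bijective_on_basis`). There `⨁ φ_r` is given by a square matrix, which is triangular,
after reversing the columns in the case of `U₀`, and its diagonal entries are the constants `x_{r, r}`
over `U₁` and `c_{k - r}` over `U₀`. The latter are `1` for `r ≥ 1`. For `r = 0` one gets
`binom(n, k)`, and it is nonzero in `F` because the matrix `(c_l(x_r))` is the product of a triangular
matrix with signs on the diagonal and of the triangular matrix `(x_{j, r})`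
(`diffCoeff_sub_ne_zero`).
-/

noncomputable section

namespace PrincipalParts

/-! ### Functions on an infinitesimal neighbourhood of the diagonal: algebra -/

section NbhdAlgebra

open Polynomial

/-- If `A` is the polynomial ring over `R` in `a`, then `P = A ⊗_R A`, with the two coprojections `f`
and `g`, is the polynomial ring over `A` in `da = g a - f a`, and the kernel of the multiplication
`d` is generated by `da`. So the quotient of `P` by the `(k + 1)`-st power of this kernel is free
over `A`, acting through `f`, on the powers `(da) ^ l` with `l ≤ k`. -/
theorem bijective_sum_pow_of_isPushout {R A P : CommRingCat.{u}} {c : R ⟶ A} {f g : A ⟶ P}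
    (h : IsPushout c c f g) (a : A) (ha : Function.Bijective (eval₂RingHom c.hom a))
    (d : P ⟶ A) (hdf : f ≫ d = 𝟙 A) (hdg : g ≫ d = 𝟙 A)
    {B : Type*} [CommRing B] (π : P →+* B) (hπ : Function.Surjective π) (k : ℕ)
    (hk : RingHom.ker π = RingHom.ker d.hom ^ (k + 1)) :
    Function.Bijective fun v : Fin (k + 1) → A =>
      ∑ l : Fin (k + 1), π (f (v l)) * π (g a - f a) ^ (l : ℕ) := by
  let e : A[X] →+* P := eval₂RingHom f.hom (g a - f a)
  let ψ : R[X] ≃+* A := RingEquiv.ofBijective _ ha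
  have hψ : ∀ p, ψ p = eval₂ c.hom a p := fun p => rfl
  -- The inverse of `e` is glued from the inclusion of constants and `a ↦ X + a`.
  let g' : A →+* A[X] := (eval₂RingHom (C.comp c.hom) (X + C a)).comp ψ.symm.toRingHom
  have hg' : ∀ p, g' (ψ p) = eval₂ (C.comp c.hom) (X + C a) p := fun p => by
    simp [g']
  have hg'a : g' a = X + C a := by
    have : a = ψ X := by simp [hψ]
    conv_lhs => rw [this]
    rw [hg']; simp
  let e' : P ⟶ CommRingCat.of A[X] := h.desc (CommRingCat.ofHom C) (CommRingCat.ofHom g') (by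
    refine CommRingCat.hom_ext (RingHom.ext fun r => ?_)
    change C (c r) = g' (c r)
    have : c r = ψ (C r) := by simp [hψ]
    conv_rhs => rw [this]
    rw [hg']; simp)
  have he'f : ∀ x, e' (f x) = C x := fun x =>
    ConcreteCategory.congr_hom (h.inl_desc _ _ _) x
  have he'g : ∀ x, e' (g x) = g' x := fun x =>
    ConcreteCategory.congr_hom (h.inr_desc _ _ _) x
  have hcf : ∀ r, f (c r) = g (c r) := fun r => ConcreteCategory.congr_hom h.w r
  have h1 : ∀ p, e' (e p) = p := by
    intro p
    have : (e'.hom.comp e) = RingHom.id _ := by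
      apply Polynomial.ringHom_ext
      · intro x; simp [e, he'f]
      · simp [e, he'f, he'g, hg'a]
    exact RingHom.congr_fun this p
  have h2 : ∀ x, e (e' x) = x := by
    have : e' ≫ CommRingCat.ofHom e = 𝟙 P := by
      apply h.hom_ext
      · ext x; simp [e, he'f]
      · ext x
        obtain ⟨p, rfl⟩ := ψ.surjective x
        simp only [CommRingCat.hom_comp, RingHom.comp_apply, CommRingCat.hom_ofHom,
          CommRingCat.hom_id, RingHom.id_apply]
        change e (e' (g _)) = _
        rw [he'g]
        change ((e.comp g').comp ψ.toRingHom) p = (g.hom.comp ψ.toRingHom) p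
        congr 1
        apply Polynomial.ringHom_ext
        · intro r
          change e (g' (ψ (C r))) = g (ψ (C r))
          rw [hg']; simp [e, hψ, hcf]
        · change e (g' (ψ X)) = g (ψ X)
          rw [hg']; simp [e, hψ]
    exact fun x => ConcreteCategory.congr_hom this x
  -- Under `e` the multiplication becomes the evaluation at `0`.
  have hker : RingHom.ker d.hom = Ideal.map e (Ideal.span {X}) := by
    have hde : ∀ p, d (e p) = p.eval 0 := by
      intro p
      have : d.hom.comp e = evalRingHom 0 := by
        apply Polynomial.ringHom_ext
        · intro x
          have := ConcreteCategory.congr_hom hdf x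
          simpa [e] using this
        · have h1 := ConcreteCategory.congr_hom hdf a
          have h2 := ConcreteCategory.congr_hom hdg a
          simp at h1 h2
          simp [e, h1, h2]
      exact RingHom.congr_fun this p
    ext x
    rw [Ideal.mem_map_iff_of_surjective e (fun x => ⟨_, h2 x⟩)]
    constructor
    · intro hx
      refine ⟨e' x, ?_, h2 x⟩
      rw [Ideal.mem_span_singleton, X_dvd_iff, coeff_zero_eq_eval_zero, ← hde, h2]
      exact hx
    · rintro ⟨p, hp, rfl⟩
      rw [Ideal.mem_span_singleton, X_dvd_iff, coeff_zero_eq_eval_zero, ← hde] at hp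
      exact hp
  have hker' : ∀ p, π (e p) = 0 ↔ (X : A[X]) ^ (k + 1) ∣ p := by
    intro p
    rw [← RingHom.mem_ker, hk, hker, ← Ideal.map_pow, Ideal.span_singleton_pow,
      Ideal.mem_map_iff_of_surjective e (fun x => ⟨_, h2 x⟩), ← Ideal.mem_span_singleton]
    constructor
    · rintro ⟨q, hq, hqp⟩
      rwa [← h1 p, ← hqp, h1]
    · exact fun hp => ⟨p, hp, rfl⟩
  -- A family of coefficients corresponds to the polynomial of degree at most `k` with them.
  let q : (Fin (k + 1) → A) → A[X] := fun v => ∑ l, C (v l) * X ^ (l : ℕ)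
  have hq : ∀ v, (∑ l : Fin (k + 1), π (f (v l)) * π (g a - f a) ^ (l : ℕ)) =
      π (e (q v)) := fun v => by
    simp [q, e]
  have hcoeff : ∀ v (l : Fin (k + 1)), (q v).coeff l = v l := by
    intro v l
    simp only [q, finsetSum_coeff, coeff_C_mul, coeff_X_pow]
    rw [Finset.sum_eq_single l]
    · simp
    · intro j _ hj
      rw [if_neg (fun h => hj (Fin.ext h.symm)), mul_zero]
    · simp
  constructor
  · intro v w hvw
    simp only [hq] at hvw
    rw [← sub_eq_zero, ← map_sub, ← map_sub, hker', X_pow_dvd_iff] at hvw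
    funext l
    have := hvw l l.2
    rw [coeff_sub, hcoeff, hcoeff, sub_eq_zero] at this
    exact this
  · intro b
    obtain ⟨x, rfl⟩ := hπ b
    refine ⟨fun l => (e' x).coeff l, ?_⟩
    simp only [hq]
    rw [← h2 x, ← sub_eq_zero, ← map_sub, ← map_sub, h2, hker', X_pow_dvd_iff]
    intro l hl
    rw [coeff_sub, hcoeff _ ⟨l, hl⟩, sub_self]

/-- A basis of the `A`-algebra `B` remains a basis after inverting `h` in `A` and its image in `B`.
The ring homomorphisms `f` and `f'` play the role of the structure maps. -/
theorem bijective_sum_of_isLocalization_away {A A' B B' : Type*} [CommRing A] [CommRing A']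
    [CommRing B] [CommRing B'] [Algebra A A'] [Algebra B B'] (h : A) [IsLocalization.Away h A']
    (f : A →+* B) (f' : A' →+* B') [IsLocalization.Away (f h) B']
    (hf : ∀ a, f' (algebraMap A A' a) = algebraMap B B' (f a)) {ι : Type*} [Fintype ι] (b : ι → B)
    (hb : Function.Bijective fun v : ι → A => ∑ l, f (v l) * b l) :
    Function.Bijective fun v : ι → A' => ∑ l, f' (v l) * algebraMap B B' (b l) := by
  classical
  have key : ∀ v : ι → A, (∑ l, f' (algebraMap A A' (v l)) * algebraMap B B' (b l)) =
      algebraMap B B' (∑ l, f (v l) * b l) := fun v => by simp [hf]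
  have hu : IsUnit (algebraMap A A' h) := IsLocalization.Away.algebraMap_isUnit h
  have hu' : IsUnit (algebraMap B B' (f h)) := IsLocalization.Away.algebraMap_isUnit (f h)
  constructor
  · -- Clearing the denominators of `v` and of the vanishing of the sum reduces this to `hb`.
    have : ∀ v : ι → A', (∑ l, f' (v l) * algebraMap B B' (b l)) = 0 → v = 0 := by
      intro v hv
      obtain ⟨⟨_, n, rfl⟩, hs⟩ := IsLocalization.exist_integer_multiples_of_finset
        (Submonoid.powers h) (Finset.univ.image v)
      have hs' : ∀ l, ∃ w : A, algebraMap A A' w = algebraMap A A' h ^ n * v l := by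
        intro l
        obtain ⟨w, hw⟩ := hs (v l) (by simp)
        exact ⟨w, by simpa [Algebra.smul_def] using hw⟩
      choose w hw using hs'
      have h1 : algebraMap B B' (∑ l, f (w l) * b l) = 0 := by
        rw [← key]
        simp only [hw, map_mul, mul_assoc]
        rw [← Finset.mul_sum, hv, mul_zero]
      obtain ⟨⟨_, m, rfl⟩, hm⟩ :=
        (IsLocalization.map_eq_zero_iff (Submonoid.powers (f h)) B' _).mp h1
      have h2 : (fun l => h ^ m * w l) = 0 := by
        apply hb.1
        simp only [map_mul, map_pow, mul_assoc, ← Finset.mul_sum] at hm ⊢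
        rw [hm]; simp
      funext l
      have h3 : algebraMap A A' (h ^ m * w l) = 0 := by
        rw [show h ^ m * w l = 0 from congrFun h2 l, map_zero]
      rw [map_mul, map_pow, hw] at h3
      exact (hu.pow n).mul_right_eq_zero.mp ((hu.pow m).mul_right_eq_zero.mp h3)
    intro v w hvw
    rw [← sub_eq_zero]
    apply this
    simp only [Pi.sub_apply, map_sub, sub_mul, Finset.sum_sub_distrib]
    exact sub_eq_zero.mpr hvw
  · intro x
    obtain ⟨n, y, hy⟩ := IsLocalization.Away.surj (f h) x
    obtain ⟨v, rfl⟩ := hb.2 y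
    refine ⟨fun l => algebraMap A A' (v l) * (↑(hu.pow n).unit⁻¹ : A'), ?_⟩
    apply (hu'.pow n).mul_left_injective
    simp only
    rw [hy, ← key, Finset.sum_mul]
    refine Finset.sum_congr rfl fun l _ => ?_
    rw [← hf h, map_mul, ← map_pow f']
    have : f' (↑(hu.pow n).unit⁻¹ : A') * f' (algebraMap A A' h ^ n) = 1 := by
      rw [← map_mul, IsUnit.val_inv_mul, map_one]
    linear_combination (f' (algebraMap A A' (v l)) * algebraMap B B' (b l)) * this

end NbhdAlgebra

/-! ### Change of coordinates from `s` to `t` -/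

section ChangeOfCoordinates

theorem neg_pow_mul_add_pow_eq_sum_coeff {B : Type*} [CommRing B] (T D : B) {n j : ℕ}
    (hj : j ≤ n) : (-D) ^ j * (T + D) ^ (n - j) =
      ∑ l ∈ Finset.range (n + 1), (coeff n j l : B) * (D ^ l * T ^ (n - l)) := by
  obtain ⟨m, rfl⟩ := Nat.exists_eq_add_of_le hj
  rw [add_assoc, Finset.sum_range_add, Finset.sum_eq_zero, zero_add, add_comm T D, add_pow,
    Nat.add_sub_cancel_left, Finset.mul_sum]
  · refine Finset.sum_congr rfl fun l hl => ?_
    rw [coeff, if_pos (Nat.le_add_right j l), Nat.add_sub_cancel_left, Nat.add_sub_cancel_left,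
      Nat.add_sub_add_left, neg_pow, pow_add]
    push_cast
    ring
  · intro l hl
    rw [coeff, if_neg (by simpa using hl), Int.cast_zero, zero_mul]

/-- The comparison of the two formulas for `φ_r` on `U₀ ∩ U₁`, as an identity in a ring `B` in which
`T`, `S` stand for `t`, `s` on the first factor and `T'`, `S'` for `t`, `s` on the second one. The
hypothesis `hx` is what the equations of `A_r x = b_r` with right hand side `0` say. -/
theorem sum_change_of_coordinates {F B : Type*} [Field F] [CommRing B] (κ : F →+* B)
    {T S T' S' : B} (hTS : T * S = 1) (hTS' : T' * S' = 1) {n k r : ℕ} (hkn : k ≤ n)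
    (hrk : r ≤ k) (hD : (T' - T) ^ (k + 1) = 0) (x : Fin (r + 1) → F)
    (hx : ∀ l, k - r < l → l ≤ k → ∑ j : Fin (r + 1), (coeff n j l : F) * x j = 0) :
    ∑ j : Fin (r + 1), κ (x j) * S ^ (r - (j : ℕ)) * ((S' - S) ^ (j : ℕ) * T' ^ n) =
      T ^ (n - k) * ∑ l ∈ Finset.range (k - r + 1),
        κ (∑ j : Fin (r + 1), (coeff n j l : F) * x j) * T ^ (k - r - l) * (T' - T) ^ l := by
  have hT : IsUnit (T ^ r) := (IsUnit.of_mul_eq_one S hTS).pow r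
  apply hT.mul_right_injective
  simp only
  set D := T' - T with hDdef
  have hT' : T' = T + D := by rw [hDdef]; ring
  -- Both sides, multiplied by `T ^ r`, are equal to the following sum.
  trans ∑ l ∈ Finset.range (k + 1),
      κ (∑ j : Fin (r + 1), (coeff n j l : F) * x j) * (D ^ l * T ^ (n - l))
  · have h1 : ∀ j : Fin (r + 1), T ^ r * (κ (x j) * S ^ (r - (j : ℕ)) *
        ((S' - S) ^ (j : ℕ) * T' ^ n)) =
        κ (x j) * ∑ l ∈ Finset.range (k + 1), (coeff n j l : B) * (D ^ l * T ^ (n - l)) := by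
      intro j
      have hj : (j : ℕ) ≤ r := Nat.lt_succ_iff.mp j.2
      have hjn : (j : ℕ) ≤ n := hj.trans (hrk.trans hkn)
      have e1 : T ^ r * S ^ (r - (j : ℕ)) = T ^ (j : ℕ) := by
        obtain ⟨m, hm⟩ := Nat.exists_eq_add_of_le hj
        rw [show r - (j : ℕ) = m by omega]
        conv_lhs => rw [hm]
        rw [pow_add, mul_assoc, ← mul_pow, hTS, one_pow, mul_one]
      have e2 : T ^ (j : ℕ) * ((S' - S) ^ (j : ℕ) * T' ^ n) =
          (-D) ^ (j : ℕ) * (T + D) ^ (n - j) := by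
        obtain ⟨m, hm⟩ := Nat.exists_eq_add_of_le hjn
        -- This is `ds = -dt / (t u)`, where `u` is `t` on the second factor.
        have : T * (S' - S) * T' = -D := by
          rw [hDdef]; linear_combination T * hTS' - T' * hTS
        rw [hm, Nat.add_sub_cancel_left, ← hT', pow_add, ← this, mul_pow, mul_pow]
        ring
      have e3 : ∑ l ∈ Finset.range (n + 1), (coeff n j l : B) * (D ^ l * T ^ (n - l)) =
          ∑ l ∈ Finset.range (k + 1), (coeff n j l : B) * (D ^ l * T ^ (n - l)) := by
        symm
        refine Finset.sum_subset (Finset.range_mono (by omega)) fun l _ hl => ?_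
        rw [Finset.mem_range, not_lt] at hl
        rw [pow_eq_zero_of_le hl hD, zero_mul, mul_zero]
      rw [← e3, ← neg_pow_mul_add_pow_eq_sum_coeff T D hjn, ← e2]
      linear_combination κ (x j) * ((S' - S) ^ (j : ℕ) * T' ^ n) * e1
    rw [Finset.mul_sum, Finset.sum_congr rfl fun j _ => h1 j]
    simp only [Finset.mul_sum, map_sum, Finset.sum_mul]
    rw [Finset.sum_comm]
    refine Finset.sum_congr rfl fun l _ => Finset.sum_congr rfl fun j _ => ?_
    rw [map_mul, map_intCast]
    ring
  · rw [Finset.mul_sum, Finset.mul_sum]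
    symm
    have h2 : ∀ l ∈ Finset.range (k - r + 1), T ^ r * (T ^ (n - k) *
        (κ (∑ j : Fin (r + 1), (coeff n j l : F) * x j) * T ^ (k - r - l) * D ^ l)) =
        κ (∑ j : Fin (r + 1), (coeff n j l : F) * x j) * (D ^ l * T ^ (n - l)) := by
      intro l hl
      rw [Finset.mem_range] at hl
      rw [show n - l = r + (n - k) + (k - r - l) by omega, pow_add, pow_add]
      ring
    rw [Finset.sum_congr rfl h2]
    refine Finset.sum_subset (Finset.range_mono (by omega)) fun l hl hl' => ?_
    rw [Finset.mem_range] at hl hl'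
    rw [hx l (by omega) (by omega), map_zero, zero_mul]

end ChangeOfCoordinates

/-! ### The linear systems -/

section LinearAlgebra

variable {F : Type*} [Field F]

/-- The coefficient `c_l = ∑_j (-1) ^ j * binom(n - j, l - j) * x_j` of `dt ^ l ⊗ x₀ ^ n` in
`φ(x₀ ^ (n - k))`. -/
def diffCoeff (n : ℕ) {r : ℕ} (x : Fin (r + 1) → F) (l : ℕ) : F :=
  ∑ j : Fin (r + 1), (coeff n j l : F) * x j

/-- Row `i` of `A_r x = b_r` is the equation for the coefficient with index `l = k - i`. -/
theorem IsSolution.diffCoeff_eq {n k r : ℕ} (hrk : r ≤ k) {x : Fin (r + 1) → F}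
    (hx : IsSolution F n k r x) {l : ℕ} (hl : k - r ≤ l) (hlk : l ≤ k) :
    diffCoeff n x l = if l = k - r then 1 else 0 := by
  have h := congrFun hx (⟨k - l, by omega⟩ : Fin (r + 1))
  simp only [Matrix.mulVec, dotProduct, Matrix.map_apply, sysMatrix, Matrix.of_apply,
    sysVector] at h
  rw [show k - (k - l) = l by omega] at h
  rw [diffCoeff, h]
  by_cases hlr : l = k - r
  · have : (⟨k - l, by omega⟩ : Fin (r + 1)) = Fin.last r := Fin.ext (by simp; omega)
    rw [this, Pi.single_eq_same, if_pos hlr, Int.cast_one]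
  · rw [Pi.single_eq_of_ne (fun h => hlr (by
      have := congrArg Fin.val h
      simp at this; omega)), if_neg hlr, Int.cast_zero]

/-- An upper triangular matrix is invertible iff its diagonal entries are. -/
theorem isUnit_iff_of_upperTriangular {A : Type*} [CommRing A] {m : ℕ}
    {M : Matrix (Fin m) (Fin m) A} (hM : ∀ i j, j < i → M i j = 0) :
    IsUnit M ↔ ∀ i, IsUnit (M i i) := by
  rw [Matrix.isUnit_iff_isUnit_det, Matrix.det_of_isUpperTriangular (fun i j h => hM i j h),
    IsUnit.prod_univ_iff]

/-- If all the systems have solutions with nonzero last entries, then the coefficients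
`c_{k - r}` of the leading terms on `U₀` are nonzero. For `r = 0` this says that `binom(n, k)` is
nonzero in `F`. -/
theorem diffCoeff_sub_ne_zero {n k : ℕ} {x : ∀ r : ℕ, Fin (r + 1) → F}
    (hx : ∀ r : ℕ, 1 ≤ r → r ≤ k → IsSolution F n k r (x r))
    (hprod : ∏ i ∈ Finset.range (k + 1), x i (Fin.last i) ≠ 0) (i : Fin (k + 1)) :
    diffCoeff n (x (k - i)) i ≠ 0 := by
  -- The matrix of all coefficients is `L * X`, where `X` is upper triangular with the entries
  -- `x_{i, i}` on the diagonal and `L` is lower triangular with signs on the diagonal. It is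
  -- also upper triangular after reversing the columns, so its diagonal entries are then units.
  let X : Matrix (Fin (k + 1)) (Fin (k + 1)) F :=
    fun j r => if h : (j : ℕ) < r + 1 then x r ⟨j, h⟩ else 0
  let L : Matrix (Fin (k + 1)) (Fin (k + 1)) F := fun l j => (coeff n j l : F)
  have hX : IsUnit X := by
    rw [isUnit_iff_of_upperTriangular]
    · intro i
      have : X i i = x i (Fin.last i) := by simp [X, Fin.last]
      rw [this, isUnit_iff_ne_zero]
      exact Finset.prod_ne_zero_iff.mp hprod i (Finset.mem_range.mpr i.2)
    · intro j r h
      have : ¬ ((j : ℕ) < r + 1) := by have := Fin.lt_def.mp h; omega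
      simp only [X, dif_neg this]
  have hL : IsUnit L := by
    rw [← Matrix.isUnit_transpose, isUnit_iff_of_upperTriangular]
    · intro i
      change IsUnit (coeff n i i : F)
      simp [coeff]
    · intro j r h
      change (coeff n j r : F) = 0
      rw [coeff, if_neg (not_le.mpr (Fin.lt_def.mp h)), Int.cast_zero]
  have hC : ∀ l r : Fin (k + 1), (L * X) l r = diffCoeff n (x r) l := by
    intro l r
    rw [Matrix.mul_apply, diffCoeff]
    let f : ℕ → F := fun j => if h : j < r + 1 then (coeff n j l : F) * x r ⟨j, h⟩ else 0
    have e : ∀ j : Fin (k + 1), L l j * X j r = f j := by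
      intro j
      simp only [L, X, f]
      split_ifs <;> simp
    have e' : ∀ j : Fin ((r : ℕ) + 1), (coeff n j l : F) * x r j = f j := fun j => by
      simp only [f, dif_pos j.2]
    rw [Finset.sum_congr rfl fun j _ => e j, Finset.sum_congr rfl fun j _ => e' j,
      Fin.sum_univ_eq_sum_range f, Fin.sum_univ_eq_sum_range f]
    symm
    refine Finset.sum_subset (Finset.range_mono (Nat.succ_le_of_lt r.2)) fun j _ hj => ?_
    rw [Finset.mem_range] at hj
    exact dif_neg hj
  have hCu := (Matrix.isUnit_submatrix_equiv (Equiv.refl _) Fin.revPerm).mpr (hL.mul hX)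
  have hdiag := (isUnit_iff_of_upperTriangular (fun l s h => ?_)).mp hCu i
  · rw [Matrix.submatrix_apply, hC] at hdiag
    have : ((Fin.revPerm i : Fin (k + 1)) : ℕ) = k - i := by simp [Fin.val_rev]
    rw [this] at hdiag
    exact hdiag.ne_zero
  · have hls := Fin.lt_def.mp h
    have hlk := l.2
    rw [Matrix.submatrix_apply, hC]
    have : ((Fin.revPerm s : Fin (k + 1)) : ℕ) = k - s := by simp [Fin.val_rev]
    rw [this, Equiv.refl_apply, (hx (k - s) (by omega) (by omega)).diffCoeff_eq (by omega)
      (by omega) (by omega), if_neg (by omega)]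

end LinearAlgebra

/-! ### Sections and morphisms of modules on a scheme -/

section Sections

variable {X : Scheme.{u}}

/-- Restriction of sections of a module. -/
abbrev mres (M : X.Modules) {U V : X.Opens} (h : U ≤ V) : Γ(M, V) →+ Γ(M, U) :=
  (M.presheaf.map (homOfLE h).op).hom

theorem mres_mres (M : X.Modules) {U V W : X.Opens} (h : U ≤ V) (h' : V ≤ W) (a : Γ(M, W)) :
    mres M h (mres M h' a) = mres M (h.trans h') a := by
  have : M.presheaf.map (homOfLE (h.trans h')).op =
      M.presheaf.map (homOfLE h').op ≫ M.presheaf.map (homOfLE h).op := by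
    rw [← M.presheaf.map_comp]; rfl
  simp only [mres]
  rw [this]; rfl

theorem mres_self (M : X.Modules) {U : X.Opens} (h : U ≤ U) (a : Γ(M, U)) : mres M h a = a := by
  have : M.presheaf.map (homOfLE h).op = 𝟙 _ := M.presheaf.map_id _
  simp only [mres]
  rw [this]; rfl

theorem res_self {U : X.Opens} (h : U ≤ U) (a : Γ(X, U)) : res h a = a := by
  have : X.presheaf.map (homOfLE h).op = 𝟙 _ := X.presheaf.map_id _
  simp only [res]
  rw [this]; rfl

theorem mres_smul (M : X.Modules) {U V : X.Opens} (h : U ≤ V) (r : Γ(X, V)) (a : Γ(M, V)) :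
    mres M h (r • a) = res h r • mres M h a :=
  M.map_smul (homOfLE h) r a

theorem mres_app {M N : X.Modules} (φ : M ⟶ N) {U V : X.Opens} (h : U ≤ V) (a : Γ(M, V)) :
    mres N h ((φ.app V).hom a) = (φ.app U).hom (mres M h a) :=
  (ConcreteCategory.congr_hom (φ.mapPresheaf.naturality (homOfLE h).op) a).symm

theorem app_smul {M N : X.Modules} (φ : M ⟶ N) {U : X.Opens} (r : Γ(X, U)) (a : Γ(M, U)) :
    (φ.app U).hom (r • a) = r • (φ.app U).hom a :=
  φ.app_smul r a

/-- Sections over a union of two open sets are determined by their restrictions. -/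
theorem mres_ext_two (M : X.Modules) {U W₀ W₁ : X.Opens} (h₀ : W₀ ≤ U) (h₁ : W₁ ≤ U)
    (hc : U ≤ W₀ ⊔ W₁) {a b : Γ(M, U)} (e₀ : mres M h₀ a = mres M h₀ b)
    (e₁ : mres M h₁ a = mres M h₁ b) : a = b :=
  TopCat.Sheaf.eq_of_locally_eq₂ ⟨M.presheaf, M.isSheaf⟩ (homOfLE h₀) (homOfLE h₁) hc a b e₀ e₁

/-- Gluing of sections over two open sets. -/
theorem exists_mres_eq_two (M : X.Modules) {U W₀ W₁ : X.Opens} (h₀ : W₀ ≤ U) (h₁ : W₁ ≤ U)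
    (hc : U ≤ W₀ ⊔ W₁) (a₀ : Γ(M, W₀)) (a₁ : Γ(M, W₁))
    (e : mres M (inf_le_left : W₀ ⊓ W₁ ≤ W₀) a₀ = mres M inf_le_right a₁) :
    ∃ a : Γ(M, U), mres M h₀ a = a₀ ∧ mres M h₁ a = a₁ := by
  let W : Bool → X.Opens := fun b => b.rec W₀ W₁
  have hW : ∀ b, W b ≤ U := fun b => b.rec h₀ h₁
  let sf : ∀ b, Γ(M, W b) := fun b => b.rec a₀ a₁
  obtain ⟨a, ha, -⟩ := TopCat.Sheaf.existsUnique_gluing' ⟨M.presheaf, M.isSheaf⟩ W U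
    (fun b => homOfLE (hW b)) (hc.trans (sup_le (le_iSup W false) (le_iSup W true))) sf (by
      intro i j
      cases i <;> cases j
      · rfl
      · exact e
      · have := congrArg (mres M (le_inf inf_le_right inf_le_left : W₁ ⊓ W₀ ≤ W₀ ⊓ W₁)) e
        rw [mres_mres, mres_mres] at this
        exact this.symm
      · rfl)
  exact ⟨a, ha false, ha true⟩

/-- A morphism of modules from compatible linear maps on sections. -/
def modulesHom {M N : X.Modules} (f : ∀ U : X.Opens, Γ(M, U) →+ Γ(N, U))
    (hs : ∀ U (r : Γ(X, U)) (a : Γ(M, U)), f U (r • a) = r • f U a)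
    (hf : ∀ (U V : X.Opens) (h : U ≤ V) (a : Γ(M, V)), f U (mres M h a) = mres N h (f V a)) :
    M ⟶ N :=
  SheafOfModules.Hom.mk (X := M) (Y := N) (PresheafOfModules.homMk
    { app := fun U => AddCommGrpCat.ofHom (f U.unop)
      naturality := fun U V i => by
        refine AddCommGrpCat.hom_ext (AddMonoidHom.ext fun a => ?_)
        exact hf V.unop U.unop i.unop.le a }
    (fun U r a => hs U.unop r a))

/-- A morphism of modules is an isomorphism if it is bijective on sections over a basis of open
sets. -/
theorem isIso_of_bijective_on_basis {M N : X.Modules} (φ : M ⟶ N) (B : Set X.Opens)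
    (hB : TopologicalSpace.Opens.IsBasis B)
    (h : ∀ U ∈ B, Function.Bijective (φ.app U).hom) : IsIso φ := by
  rw [Scheme.Modules.Hom.isIso_iff_isIso_app]
  intro U
  rw [ConcreteCategory.isIso_iff_bijective]
  have hcov : ∃ (ι : Type u) (W : ι → X.Opens), (∀ i, W i ∈ B) ∧ U = iSup W := by
    obtain ⟨S, hS, hU⟩ := TopologicalSpace.Opens.isBasis_iff_cover.mp hB U
    exact ⟨S, Subtype.val, fun i => hS i.2, by rw [hU, sSup_eq_iSup']⟩
  obtain ⟨ι, W, hW, hU⟩ := hcov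
  have hle : ∀ i, W i ≤ U := fun i => hU ▸ le_iSup W i
  have inj : ∀ V : X.Opens, Function.Injective (φ.app V).hom := by
    intro V a b hab
    obtain ⟨S, hS, hV⟩ := TopologicalSpace.Opens.isBasis_iff_cover.mp hB V
    have hle : ∀ i : S, i.1 ≤ V := fun i => hV ▸ le_sSup i.2
    refine TopCat.Sheaf.eq_of_locally_eq' ⟨M.presheaf, M.isSheaf⟩ (fun i : S => i.1) V
      (fun i => homOfLE (hle i)) (by rw [hV, sSup_eq_iSup']) a b fun i => ?_
    apply (h i.1 (hS i.2)).1
    have := congrArg (mres N (hle i)) hab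
    rw [mres_app, mres_app] at this
    exact this
  refine ⟨inj U, fun b => ?_⟩
  choose a ha using fun i => (h (W i) (hW i)).2 (mres N (hle i) b)
  obtain ⟨c, hc, -⟩ := TopCat.Sheaf.existsUnique_gluing' ⟨M.presheaf, M.isSheaf⟩ W U
    (fun i => homOfLE (hle i)) hU.le a (by
      intro i j
      apply inj
      have h1 := mres_app φ (inf_le_left : W i ⊓ W j ≤ W i) (a i)
      have h2 := mres_app φ (inf_le_right : W i ⊓ W j ≤ W j) (a j)
      rw [ha, mres_mres] at h1 h2
      exact h1.symm.trans h2)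
  refine ⟨c, ?_⟩
  refine TopCat.Sheaf.eq_of_locally_eq' ⟨N.presheaf, N.isSheaf⟩ W U
    (fun i => homOfLE (hle i)) hU.le _ _ fun i => ?_
  have h1 := mres_app φ (hle i) c
  have h2 : mres M (hle i) c = a i := hc i
  rw [h2, ha] at h1
  exact h1

end Sections

/-! ### Generators and the universal property of a glued module -/

section GlueUniversal

variable {X : Scheme.{u}} {V₀ V₁ : X.Opens} {g h : Γ(X, V₀ ⊓ V₁)}

/-- The generator of the glued module over `V₀`, the pair `(1, g⁻¹)`. The inverse of `g` is an
explicit function `h`. -/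
def glueGen₀ (hgh : g * h = 1) : Γ(glueModule V₀ V₁ g, V₀) :=
  (⟨(1, h), by
    change res (inf_le_inf_left _ inf_le_left) 1 =
      res (inf_le_right : V₀ ⊓ (V₀ ⊓ V₁) ≤ _) g * res (inf_le_inf_left _ inf_le_right) h
    have := congrArg (res (inf_le_right : V₀ ⊓ (V₀ ⊓ V₁) ≤ _)) hgh
    rw [map_mul] at this
    rw [this, map_one, map_one]⟩ : glueSec V₀ V₁ g V₀)

variable (g) in
/-- The generator of the glued module over `V₁`, the pair `(g, 1)`. -/
def glueGen₁ : Γ(glueModule V₀ V₁ g, V₁) :=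
  (⟨(res (inf_comm _ _).le g, 1), by
    change res (inf_le_inf_left _ inf_le_left) (res (inf_comm _ _).le g) =
      res (inf_le_right : V₁ ⊓ (V₀ ⊓ V₁) ≤ _) g * res (inf_le_inf_left _ inf_le_right) 1
    rw [res_res, map_one, mul_one]⟩ : glueSec V₀ V₁ g V₁)

/-- On `V₀ ∩ V₁` the two generators differ by the transition function. -/
theorem mres_glueGen₁_eq (hgh : g * h = 1) :
    mres (glueModule V₀ V₁ g) inf_le_right (glueGen₁ g) =
      g • mres (glueModule V₀ V₁ g) (inf_le_left : V₀ ⊓ V₁ ≤ V₀) (glueGen₀ hgh) := by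
  apply glueSec_ext
  · change res _ (res _ g) = res _ g * res _ 1
    rw [res_res, map_one, mul_one]
  · change res _ 1 = res _ g * res _ h
    rw [map_one]
    have := congrArg (res (inf_le_left : V₀ ⊓ V₁ ⊓ V₁ ≤ V₀ ⊓ V₁)) hgh
    rw [map_mul, map_one] at this
    exact this.symm

theorem glueSec_eq_smul₀ (hgh : g * h = 1) {U : X.Opens} (hU : U ≤ V₀)
    (a : Γ(glueModule V₀ V₁ g, U)) :
    a = res (le_inf le_rfl hU) (Subtype.val (p := (· ∈ glueSec V₀ V₁ g U)) a).1 •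
      mres (glueModule V₀ V₁ g) hU (glueGen₀ hgh) := by
  apply glueSec_ext
  · change _ = res _ (res _ _) * res _ 1
    rw [res_res, res_self, map_one, mul_one]
  · change _ = res _ (res _ _) * res _ h
    have ha := (Subtype.prop (p := (· ∈ glueSec V₀ V₁ g U)) a)
    change res _ _ = res _ g * res _ _ at ha
    have ha' := congrArg (res (le_inf inf_le_left (le_inf (inf_le_left.trans hU) inf_le_right) :
      U ⊓ V₁ ≤ U ⊓ (V₀ ⊓ V₁))) ha
    rw [map_mul, res_res, res_res, res_res, res_self] at ha'
    have := congrArg (res (le_inf (inf_le_left.trans hU) inf_le_right : U ⊓ V₁ ≤ V₀ ⊓ V₁)) hgh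
    rw [map_mul, map_one] at this
    rw [res_res, ha', mul_right_comm, this, one_mul]

theorem glueSec_eq_smul₁ {U : X.Opens} (hU : U ≤ V₁) (a : Γ(glueModule V₀ V₁ g, U)) :
    a = res (le_inf le_rfl hU) (Subtype.val (p := (· ∈ glueSec V₀ V₁ g U)) a).2 •
      mres (glueModule V₀ V₁ g) hU (glueGen₁ g) := by
  apply glueSec_ext
  · change _ = res _ (res _ _) * res _ (res _ g)
    have ha := (Subtype.prop (p := (· ∈ glueSec V₀ V₁ g U)) a)
    change res _ _ = res _ g * res _ _ at ha
    have ha' := congrArg (res (le_inf inf_le_left (le_inf inf_le_right (inf_le_left.trans hU)) :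
      U ⊓ V₀ ≤ U ⊓ (V₀ ⊓ V₁))) ha
    rw [map_mul, res_res, res_res, res_res, res_self] at ha'
    rw [res_res, res_res, mul_comm]
    exact ha'
  · change _ = res _ (res _ _) * res _ 1
    rw [res_res, res_self, map_one, mul_one]

theorem glueGen₀_smul_injective (hgh : g * h = 1) {U : X.Opens} (hU : U ≤ V₀) :
    Function.Injective fun r : Γ(X, U) => r • mres (glueModule V₀ V₁ g) hU (glueGen₀ hgh) := by
  intro r r' hr
  have h1 := congrArg (fun a : glueSec V₀ V₁ g U => res (le_inf le_rfl hU : U ≤ U ⊓ V₀) a.1.1) hr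
  change res _ (res _ r * res _ 1) = res _ (res _ r' * res _ 1) at h1
  rw [map_one, mul_one, mul_one, res_res, res_res, res_self, res_self] at h1
  exact h1

theorem glueGen₁_smul_injective {U : X.Opens} (hU : U ≤ V₁) :
    Function.Injective fun r : Γ(X, U) => r • mres (glueModule V₀ V₁ g) hU (glueGen₁ g) := by
  intro r r' hr
  have h1 := congrArg (fun a : glueSec V₀ V₁ g U => res (le_inf le_rfl hU : U ≤ U ⊓ V₁) a.1.2) hr
  change res _ (res _ r * res _ 1) = res _ (res _ r' * res _ 1) at h1
  rw [map_one, mul_one, mul_one, res_res, res_res, res_self, res_self] at h1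
  exact h1

/-- Morphisms from the glued module are determined by the images of the two generators. -/
theorem glueModule_hom_ext (hgh : g * h = 1) (hV : V₀ ⊔ V₁ = ⊤) {M : X.Modules}
    {φ ψ : glueModule V₀ V₁ g ⟶ M}
    (h₀ : (φ.app V₀).hom (glueGen₀ hgh) = (ψ.app V₀).hom (glueGen₀ hgh))
    (h₁ : (φ.app V₁).hom (glueGen₁ g) = (ψ.app V₁).hom (glueGen₁ g)) : φ = ψ := by
  refine Scheme.Modules.hom_ext _ _ fun U => AddCommGrpCat.hom_ext (AddMonoidHom.ext fun a => ?_)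
  refine mres_ext_two M (inf_le_left : U ⊓ V₀ ≤ U) (inf_le_left : U ⊓ V₁ ≤ U)
    (by rw [← inf_sup_left, hV, inf_top_eq]) ?_ ?_
  · rw [mres_app, mres_app, glueSec_eq_smul₀ hgh inf_le_right (mres _ _ a), app_smul, app_smul,
      ← mres_app, ← mres_app, h₀]
  · rw [mres_app, mres_app, glueSec_eq_smul₁ inf_le_right (mres _ _ a), app_smul, app_smul,
      ← mres_app, ← mres_app, h₁]

/-- The section which the pair `(a₀, a₁)` is sent to by the morphism with `e₀` and `e₁` as images
of the generators: it is `a₀ e₀` on `U ∩ V₀` and `a₁ e₁` on `U ∩ V₁`. -/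
theorem exists_glue_image (hV : V₀ ⊔ V₁ = ⊤) {M : X.Modules} {e₀ : Γ(M, V₀)} {e₁ : Γ(M, V₁)}
    (he : mres M inf_le_right e₁ = g • mres M (inf_le_left : V₀ ⊓ V₁ ≤ V₀) e₀)
    {U : X.Opens} (a : glueSec V₀ V₁ g U) :
    ∃ m : Γ(M, U), mres M inf_le_left m = a.1.1 • mres M inf_le_right e₀ ∧
      mres M inf_le_left m = a.1.2 • mres M inf_le_right e₁ := by
  refine exists_mres_eq_two M inf_le_left inf_le_left (by rw [← inf_sup_left, hV, inf_top_eq])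
    _ _ ?_
  have ha := a.2
  change res _ _ = res _ g * res _ _ at ha
  have hle : (U ⊓ V₀) ⊓ (U ⊓ V₁) ≤ U ⊓ (V₀ ⊓ V₁) :=
    le_inf (inf_le_left.trans inf_le_left) (inf_le_inf inf_le_right inf_le_right)
  have ha' := congrArg (res hle) ha
  have he' := congrArg (mres M (hle.trans inf_le_right)) he
  rw [map_mul, res_res, res_res, res_res] at ha'
  rw [mres_smul, mres_mres, mres_mres] at he'
  rw [mres_smul, mres_smul, mres_mres, mres_mres, ha', he', smul_smul, mul_comm]

/-- The morphism from the glued module which sends the generators to `e₀` and `e₁`. -/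
theorem exists_glueModule_hom (hgh : g * h = 1) (hV : V₀ ⊔ V₁ = ⊤) {M : X.Modules}
    (e₀ : Γ(M, V₀)) (e₁ : Γ(M, V₁))
    (he : mres M inf_le_right e₁ = g • mres M (inf_le_left : V₀ ⊓ V₁ ≤ V₀) e₀) :
    ∃ φ : glueModule V₀ V₁ g ⟶ M, (φ.app V₀).hom (glueGen₀ hgh) = e₀ ∧
      (φ.app V₁).hom (glueGen₁ g) = e₁ := by
  choose f hf using fun U => exists_glue_image (U := U) hV he
  have hu : ∀ U (a : glueSec V₀ V₁ g U) (m : Γ(M, U)),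
      mres M inf_le_left m = a.1.1 • mres M (inf_le_right : U ⊓ V₀ ≤ V₀) e₀ →
      mres M inf_le_left m = a.1.2 • mres M (inf_le_right : U ⊓ V₁ ≤ V₁) e₁ → f U a = m :=
    fun U a m h₀ h₁ => mres_ext_two M (inf_le_left : U ⊓ V₀ ≤ U) (inf_le_left : U ⊓ V₁ ≤ U)
      (by rw [← inf_sup_left, hV, inf_top_eq]) ((hf U a).1.trans h₀.symm)
      ((hf U a).2.trans h₁.symm)
  let φ : glueModule V₀ V₁ g ⟶ M := modulesHom
    (fun U => AddMonoidHom.mk' (f U) (fun a b => hu U _ _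
      (by rw [map_add, (hf U a).1, (hf U b).1, ← add_smul]; rfl)
      (by rw [map_add, (hf U a).2, (hf U b).2, ← add_smul]; rfl)))
    (fun U r a => hu U _ _
      (by rw [mres_smul]; erw [(hf U a).1]; rw [smul_smul]; rfl)
      (by rw [mres_smul]; erw [(hf U a).2]; rw [smul_smul]; rfl))
    (fun U V i a => hu U _ _ (by
        have := congrArg (mres M (inf_le_inf_right V₀ i)) (hf V a).1
        rw [mres_smul, mres_mres, mres_mres] at this
        rw [mres_mres]
        exact this)
      (by
        have := congrArg (mres M (inf_le_inf_right V₁ i)) (hf V a).2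
        rw [mres_smul, mres_mres, mres_mres] at this
        rw [mres_mres]
        exact this))
  refine ⟨φ, hu _ _ _ ?_ ?_, hu _ _ _ ?_ ?_⟩
  · change _ = (1 : Γ(X, _)) • _
    rw [one_smul]
  · change _ = h • _
    rw [he, smul_smul, mul_comm, hgh, one_smul]
  · change _ = res _ g • _
    have := congrArg (mres M ((inf_comm _ _).le : V₁ ⊓ V₀ ≤ V₀ ⊓ V₁)) he
    rw [mres_smul, mres_mres, mres_mres] at this
    exact this
  · change _ = (1 : Γ(X, _)) • _
    rw [one_smul]

end GlueUniversal

/-! ### Pullbacks of glued modules -/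

section PullbackGlue

variable {X Z : Scheme.{u}} (q : Z ⟶ X)

/-- The section `q^* e` of `q^* E` over `q⁻¹ U` given by a section `e` of `E` over `U`. -/
def pullSec (E : X.Modules) {U : X.Opens} (e : Γ(E, U)) :
    Γ((Scheme.Modules.pullback q).obj E, q ⁻¹ᵁ U) :=
  (((Scheme.Modules.pullbackPushforwardAdjunction q).unit.app E).app U).hom e

theorem pullSec_smul (E : X.Modules) {U : X.Opens} (r : Γ(X, U)) (e : Γ(E, U)) :
    pullSec q E (r • e) = (q.app U).hom r • pullSec q E e :=
  app_smul ((Scheme.Modules.pullbackPushforwardAdjunction q).unit.app E) r e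

theorem pullSec_mres (E : X.Modules) {U V : X.Opens} (h : U ≤ V) (e : Γ(E, V)) :
    pullSec q E (mres E h e) =
      mres ((Scheme.Modules.pullback q).obj E) (q.preimage_mono h)
        (pullSec q E e) :=
  (mres_app ((Scheme.Modules.pullbackPushforwardAdjunction q).unit.app E) h e).symm

/-- The morphism adjoint to `φ` sends `e` to the image of `q^* e` under `φ`. -/
theorem homEquiv_app_pullSec {E : X.Modules} {K : Z.Modules}
    (φ : (Scheme.Modules.pullback q).obj E ⟶ K) {U : X.Opens} (e : Γ(E, U)) :
    ((((Scheme.Modules.pullbackPushforwardAdjunction q).homEquiv E K φ).app U).hom e : Γ(K, q ⁻¹ᵁ U))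
      = (φ.app (q ⁻¹ᵁ U)).hom (pullSec q E e) := by
  have := (Scheme.Modules.pullbackPushforwardAdjunction q).homEquiv_unit (X := E) (f := φ)
  exact congrArg (fun ψ : E ⟶ (Scheme.Modules.pushforward q).obj K => (ψ.app U).hom e) this

theorem app_res {U V : X.Opens} (h : U ≤ V) (a : Γ(X, V)) :
    (q.app U).hom (res h a) = res (q.preimage_mono h) ((q.app V).hom a) :=
  ConcreteCategory.congr_hom (q.naturality (homOfLE h).op) a

/-- The pullback of functions on the intersection of two open sets, with values in the functions on
the intersection of the preimages, which is the preimage of the intersection by definition. -/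
def appInf (V₀ V₁ : X.Opens) : Γ(X, V₀ ⊓ V₁) →+* Γ(Z, q ⁻¹ᵁ V₀ ⊓ q ⁻¹ᵁ V₁) :=
  (q.app (V₀ ⊓ V₁)).hom

variable {V₀ V₁ : X.Opens} {g h : Γ(X, V₀ ⊓ V₁)}

theorem mres_pullSec_glueGen₁ (hgh : g * h = 1) :
    mres ((Scheme.Modules.pullback q).obj (glueModule V₀ V₁ g))
      (inf_le_right : q ⁻¹ᵁ V₀ ⊓ q ⁻¹ᵁ V₁ ≤ q ⁻¹ᵁ V₁) (pullSec q _ (glueGen₁ g)) =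
    appInf q V₀ V₁ g •
      mres ((Scheme.Modules.pullback q).obj (glueModule V₀ V₁ g))
        (inf_le_left : q ⁻¹ᵁ V₀ ⊓ q ⁻¹ᵁ V₁ ≤ q ⁻¹ᵁ V₀) (pullSec q _ (glueGen₀ hgh)) := by
  have h1 := congrArg (pullSec q (glueModule V₀ V₁ g)) (mres_glueGen₁_eq hgh)
  rw [pullSec_smul, pullSec_mres, pullSec_mres] at h1
  exact h1

theorem pullback_glueModule_hom_ext (hgh : g * h = 1) (hV : V₀ ⊔ V₁ = ⊤) {K : Z.Modules}
    {φ ψ : (Scheme.Modules.pullback q).obj (glueModule V₀ V₁ g) ⟶ K}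
    (h₀ : (φ.app (q ⁻¹ᵁ V₀)).hom (pullSec q _ (glueGen₀ hgh)) =
      (ψ.app (q ⁻¹ᵁ V₀)).hom (pullSec q _ (glueGen₀ hgh)))
    (h₁ : (φ.app (q ⁻¹ᵁ V₁)).hom (pullSec q _ (glueGen₁ g)) =
      (ψ.app (q ⁻¹ᵁ V₁)).hom (pullSec q _ (glueGen₁ g))) : φ = ψ := by
  apply ((Scheme.Modules.pullbackPushforwardAdjunction q).homEquiv _ _).injective
  rw [← homEquiv_app_pullSec, ← homEquiv_app_pullSec] at h₀ h₁
  exact glueModule_hom_ext hgh hV h₀ h₁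

/-- The pullback of a glued module is the glued module for the pulled back transition function:
both represent the pairs of sections over the two open sets which are compatible with the
transition function. -/
theorem exists_isIso_glueModule_pullback (hgh : g * h = 1) (hV : V₀ ⊔ V₁ = ⊤) :
    ∃ (hgh' : appInf q V₀ V₁ g *
        appInf q V₀ V₁ h = 1)
      (β : glueModule (q ⁻¹ᵁ V₀) (q ⁻¹ᵁ V₁) (appInf q V₀ V₁ g) ⟶
        (Scheme.Modules.pullback q).obj (glueModule V₀ V₁ g)), IsIso β ∧
      (β.app (q ⁻¹ᵁ V₀)).hom (glueGen₀ hgh') = pullSec q _ (glueGen₀ hgh) ∧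
      (β.app (q ⁻¹ᵁ V₁)).hom (glueGen₁ _) = pullSec q _ (glueGen₁ g) := by
  have hgh' : appInf q V₀ V₁ g *
        appInf q V₀ V₁ h = 1 := by
    rw [← map_mul, hgh, map_one]
  have hV' : q ⁻¹ᵁ V₀ ⊔ q ⁻¹ᵁ V₁ = ⊤ := by
    change q ⁻¹ᵁ (V₀ ⊔ V₁) = ⊤
    rw [hV]; rfl
  obtain ⟨β, hβ₀, hβ₁⟩ := exists_glueModule_hom hgh' hV' _ _ (mres_pullSec_glueGen₁ q hgh)
  obtain ⟨γ, hγ₀, hγ₁⟩ := exists_glueModule_hom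
    (M := (Scheme.Modules.pushforward q).obj (glueModule (q ⁻¹ᵁ V₀) (q ⁻¹ᵁ V₁) (appInf q V₀ V₁ g)))
    hgh hV (glueGen₀ hgh') (glueGen₁ (appInf q V₀ V₁ g)) (mres_glueGen₁_eq hgh')
  obtain ⟨α, rfl⟩ := ((Scheme.Modules.pullbackPushforwardAdjunction q).homEquiv _ _).surjective γ
  have hα₀ := (homEquiv_app_pullSec q α (glueGen₀ hgh)).symm.trans hγ₀
  have hα₁ := (homEquiv_app_pullSec q α (glueGen₁ g)).symm.trans hγ₁
  refine ⟨hgh', β, ⟨α, ?_, ?_⟩, hβ₀, hβ₁⟩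
  · apply glueModule_hom_ext hgh' hV'
    · exact (congrArg (α.app _).hom hβ₀).trans hα₀
    · exact (congrArg (α.app _).hom hβ₁).trans hα₁
  · apply pullback_glueModule_hom_ext q hgh hV
    · exact (congrArg (β.app _).hom hα₀).trans hβ₀
    · exact (congrArg (β.app _).hom hα₁).trans hβ₁

theorem app_bijective {X : Scheme.{u}} {M N : X.Modules} (φ : M ⟶ N) [IsIso φ] (U : X.Opens) :
    Function.Bijective (φ.app U).hom :=
  ConcreteCategory.bijective_of_isIso (φ.app U)

theorem pullSec_glueGen₀_smul_bijective (hgh : g * h = 1) (hV : V₀ ⊔ V₁ = ⊤) {W : Z.Opens}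
    (hW : W ≤ q ⁻¹ᵁ V₀) : Function.Bijective fun r : Γ(Z, W) =>
      r • mres ((Scheme.Modules.pullback q).obj (glueModule V₀ V₁ g)) hW
        (pullSec q _ (glueGen₀ hgh)) := by
  obtain ⟨hgh', β, hβ, h₀, -⟩ := exists_isIso_glueModule_pullback q hgh hV
  have := (app_bijective β W).comp ⟨glueGen₀_smul_injective hgh' hW, fun a =>
    ⟨_, (glueSec_eq_smul₀ hgh' hW a).symm⟩⟩
  convert this using 1
  funext r
  rw [Function.comp, app_smul, ← mres_app, h₀]

theorem pullSec_glueGen₁_smul_bijective (hgh : g * h = 1) (hV : V₀ ⊔ V₁ = ⊤) {W : Z.Opens}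
    (hW : W ≤ q ⁻¹ᵁ V₁) : Function.Bijective fun r : Γ(Z, W) =>
      r • mres ((Scheme.Modules.pullback q).obj (glueModule V₀ V₁ g)) hW
        (pullSec q _ (glueGen₁ g)) := by
  obtain ⟨hgh', β, hβ, -, h₁⟩ := exists_isIso_glueModule_pullback q hgh hV
  have := (app_bijective β W).comp ⟨glueGen₁_smul_injective hW, fun a =>
    ⟨_, (glueSec_eq_smul₁ hW a).symm⟩⟩
  convert this using 1
  funext r
  rw [Function.comp, app_smul, ← mres_app, h₁]

end PullbackGlue

/-! ### Infinitesimal neighbourhoods of the diagonal over an affine open set with a coordinate -/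

section Neighbourhood

variable {X S : Scheme.{u}} (f : X ⟶ S)

theorem ker_appLE_of_eq {X Y : Scheme.{u}} (f : X ⟶ Y) {V : Y.Opens} {W : X.Opens}
    (h : W = f ⁻¹ᵁ V) :
    RingHom.ker (f.appLE V W h.le).hom = RingHom.ker (f.app V).hom := by
  subst h
  rw [Scheme.Hom.app_eq_appLE]

theorem appLE_surjective_of_eq {X Y : Scheme.{u}} (f : X ⟶ Y) {V : Y.Opens} {W : X.Opens}
    (h : W = f ⁻¹ᵁ V) (hf : Function.Surjective (f.app V).hom) :
    Function.Surjective (f.appLE V W h.le).hom := by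
  subst h
  rwa [← Scheme.Hom.app_eq_appLE]

/-- The open set `U × U` of `X × X`. -/
abbrev sqOpen (U : X.Opens) : (pullback f f).Opens :=
  pullback.fst f f ⁻¹ᵁ U ⊓ pullback.snd f f ⁻¹ᵁ U

/-- Over the affine open set `U`, the functions on `U × U` are `𝒪(U) ⊗ 𝒪(U)`. -/
theorem isPushout_sqOpen [IsAffine S] {U : X.Opens} (hU : IsAffineOpen U) :
    IsPushout (f.appLE ⊤ U le_top) (f.appLE ⊤ U le_top)
      ((pullback.fst f f).appLE U (sqOpen f U) inf_le_left)
      ((pullback.snd f f).appLE U (sqOpen f U) inf_le_right) :=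
  (isIso_pushoutSection_iff (IsPullback.of_hasPullback f f) (US := ⊤) (UT := U) (UX := U)
    le_top le_top rfl).mp
    (isIso_pushoutSection_of_isAffineOpen _ _ _ _ (isAffineOpen_top S) hU hU)

theorem isAffineOpen_sqOpen [IsAffine S] {U : X.Opens} (hU : IsAffineOpen U) :
    IsAffineOpen (sqOpen f U) :=
  have : IsAffine _ := isAffineOpen_top S
  have : IsAffine _ := hU
  .of_isIso (Scheme.Hom.isPullback_resLE (IsPullback.of_hasPullback f f) (US := ⊤) (UT := U)
    (UX := U) le_top le_top rfl).isoPullback.hom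

theorem diagonal_preimage_sqOpen (U : X.Opens) : U = pullback.diagonal f ⁻¹ᵁ sqOpen f U := by
  have h1 : pullback.diagonal f ⁻¹ᵁ (pullback.fst f f ⁻¹ᵁ U) = U := by
    rw [← Scheme.Hom.comp_preimage, pullback.diagonal_fst]; rfl
  have h2 : pullback.diagonal f ⁻¹ᵁ (pullback.snd f f ⁻¹ᵁ U) = U := by
    rw [← Scheme.Hom.comp_preimage, pullback.diagonal_snd]; rfl
  rw [Scheme.Hom.preimage_inf, h1, h2, inf_idem]

theorem fst_appLE_comp_diagonal (U : X.Opens) :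
    (pullback.fst f f).appLE U (sqOpen f U) inf_le_left ≫
      (pullback.diagonal f).appLE (sqOpen f U) U (diagonal_preimage_sqOpen f U).le = 𝟙 _ := by
  rw [Scheme.Hom.appLE_comp_appLE]
  simp only [pullback.diagonal_fst]
  simp only [Scheme.Hom.appLE, Scheme.Hom.id_app]
  exact (Category.id_comp _).trans (X.presheaf.map_id _)

theorem snd_appLE_comp_diagonal (U : X.Opens) :
    (pullback.snd f f).appLE U (sqOpen f U) inf_le_right ≫
      (pullback.diagonal f).appLE (sqOpen f U) U (diagonal_preimage_sqOpen f U).le = 𝟙 _ := by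
  rw [Scheme.Hom.appLE_comp_appLE]
  simp only [pullback.diagonal_snd]
  simp only [Scheme.Hom.appLE, Scheme.Hom.id_app]
  exact (Category.id_comp _).trans (X.presheaf.map_id _)

theorem projLeft_preimage_mono (k : ℕ) {U V : X.Opens} (h : U ≤ V) :
    projLeft f k ⁻¹ᵁ U ≤ projLeft f k ⁻¹ᵁ V := (projLeft f k).preimage_mono h

variable [IsSeparated f] (k : ℕ) {U : X.Opens}

/-- As the infinitesimal neighbourhood is supported on the diagonal, its part over `U` for the first
projection is its part in `U × U`. -/
theorem projLeft_preimage_eq (U : X.Opens) : projLeft f k ⁻¹ᵁ U =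
    ((pullback.diagonal f).ker ^ (k + 1)).subschemeι ⁻¹ᵁ sqOpen f U :=
  le_antisymm (fun _ hx => ⟨hx, projLeft_preimage_le f k U hx⟩) (fun _ hx => hx.1)

theorem diffSec_eq (a : Γ(X, U)) : diffSec f k a =
    (((pullback.diagonal f).ker ^ (k + 1)).subschemeι.appLE (sqOpen f U) (projLeft f k ⁻¹ᵁ U)
      (projLeft_preimage_eq f k U).le).hom
      (((pullback.snd f f).appLE U (sqOpen f U) inf_le_right).hom a -
        ((pullback.fst f f).appLE U (sqOpen f U) inf_le_left).hom a) := by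
  rw [map_sub]
  simp only [← RingHom.comp_apply, ← CommRingCat.hom_comp,
    Scheme.Hom.appLE_comp_appLE]
  rw [diffSec, Scheme.Hom.app_eq_appLE (f := projLeft f k)]
  rfl

theorem projLeft_app_eq (a : Γ(X, U)) : ((projLeft f k).app U).hom a =
    (((pullback.diagonal f).ker ^ (k + 1)).subschemeι.appLE (sqOpen f U) (projLeft f k ⁻¹ᵁ U)
      (projLeft_preimage_eq f k U).le).hom
      (((pullback.fst f f).appLE U (sqOpen f U) inf_le_left).hom a) := by
  simp only [← RingHom.comp_apply, ← CommRingCat.hom_comp, Scheme.Hom.appLE_comp_appLE]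
  rw [Scheme.Hom.app_eq_appLE]
  rfl

/-- Over `U × U`, the ideal of the infinitesimal neighbourhood is the power of the kernel of the
restriction of functions to the diagonal. -/
theorem ker_subschemeι_appLE [IsAffine S] (hU : IsAffineOpen U) :
    RingHom.ker (((pullback.diagonal f).ker ^ (k + 1)).subschemeι.appLE (sqOpen f U)
      (projLeft f k ⁻¹ᵁ U) (projLeft_preimage_eq f k U).le).hom =
    RingHom.ker ((pullback.diagonal f).appLE (sqOpen f U) U
      (diagonal_preimage_sqOpen f U).le).hom ^ (k + 1) := by
  rw [ker_appLE_of_eq _ (projLeft_preimage_eq f k U),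
    ker_appLE_of_eq _ (diagonal_preimage_sqOpen f U)]
  have h := Scheme.IdealSheafData.ker_subschemeι_app ((pullback.diagonal f).ker ^ (k + 1))
    ⟨sqOpen f U, isAffineOpen_sqOpen f hU⟩
  refine h.trans ?_
  rw [Scheme.IdealSheafData.ideal_pow, Pi.pow_apply, Scheme.Hom.ker_apply]

theorem diffSec_pow_eq_zero [IsAffine S] (hU : IsAffineOpen U) (a : Γ(X, U)) :
    diffSec f k a ^ (k + 1) = 0 := by
  rw [diffSec_eq, ← map_pow, ← RingHom.mem_ker, ker_subschemeι_appLE f k hU]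
  apply Ideal.pow_mem_pow
  rw [RingHom.mem_ker, map_sub, sub_eq_zero]
  exact (ConcreteCategory.congr_hom (snd_appLE_comp_diagonal f U) a).trans
    (ConcreteCategory.congr_hom (fst_appLE_comp_diagonal f U) a).symm

/-- Over an affine open set with a coordinate `a`, the powers of `da` form a basis of the functions
on the infinitesimal neighbourhood of the diagonal. -/
theorem diffSec_pow_bijective [IsAffine S] (hU : IsAffineOpen U) (a : Γ(X, U))
    (ha : Function.Bijective (Polynomial.eval₂RingHom (f.appLE ⊤ U le_top).hom a)) :
    Function.Bijective fun v : Fin (k + 1) → Γ(X, U) =>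
      ∑ l : Fin (k + 1), ((projLeft f k).app U).hom (v l) * diffSec f k a ^ (l : ℕ) := by
  simp only [projLeft_app_eq, diffSec_eq]
  refine bijective_sum_pow_of_isPushout (isPushout_sqOpen f hU) a ha _
    (fst_appLE_comp_diagonal f U) (snd_appLE_comp_diagonal f U) _ ?_ k
    (ker_subschemeι_appLE f k hU)
  exact appLE_surjective_of_eq _ (projLeft_preimage_eq f k U)
    (Scheme.IdealSheafData.subschemeι_app_surjective _ ⟨sqOpen f U, isAffineOpen_sqOpen f hU⟩)

theorem isAffineOpen_projLeft_preimage [IsAffine S] (hU : IsAffineOpen U) :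
    IsAffineOpen (projLeft f k ⁻¹ᵁ U) := by
  rw [projLeft_preimage_eq]
  exact (isAffineOpen_sqOpen f hU).preimage _

theorem diffSec_res {U V : X.Opens} (h : U ≤ V) (a : Γ(X, V)) :
    res (projLeft_preimage_mono f k h) (diffSec f k a) = diffSec f k (res h a) := by
  change res _ (res _ _ - _) = res _ _ - _
  rw [map_sub, app_res, app_res, res_res, res_res]

/-- Over a basic open subset of an affine open set with a coordinate `a`, the powers of `da` form
a basis of the functions on the infinitesimal neighbourhood of the diagonal. -/
theorem diffSec_pow_bijective_basicOpen [IsAffine S] (hU : IsAffineOpen U) (a : Γ(X, U))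
    (ha : Function.Bijective (Polynomial.eval₂RingHom (f.appLE ⊤ U le_top).hom a))
    {W : X.Opens} (b : Γ(X, U)) (hb : W = X.basicOpen b) (hW : W ≤ U) :
    Function.Bijective fun v : Fin (k + 1) → Γ(X, W) =>
      ∑ l : Fin (k + 1), ((projLeft f k).app W).hom (v l) *
        diffSec f k (res hW a) ^ (l : ℕ) := by
  subst hb
  let _ : Algebra Γ(X, U) Γ(X, X.basicOpen b) := (res hW).toAlgebra
  let _ : Algebra Γ(infNhd f k, projLeft f k ⁻¹ᵁ U)
      Γ(infNhd f k, projLeft f k ⁻¹ᵁ X.basicOpen b) :=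
    (res (projLeft_preimage_mono f k hW)).toAlgebra
  have : IsLocalization.Away b Γ(X, X.basicOpen b) := hU.isLocalization_basicOpen b
  have : IsLocalization.Away (((projLeft f k).app U).hom b)
      Γ(infNhd f k, projLeft f k ⁻¹ᵁ X.basicOpen b) :=
    (isAffineOpen_projLeft_preimage f k hU).isLocalization_of_eq_basicOpen
      (((projLeft f k).app U).hom b)
      (homOfLE (projLeft_preimage_mono f k hW))
      (Scheme.preimage_basicOpen (projLeft f k) b)
  have := bijective_sum_of_isLocalization_away b ((projLeft f k).app U).hom
    ((projLeft f k).app (X.basicOpen b)).hom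
    (B' := Γ(infNhd f k, projLeft f k ⁻¹ᵁ X.basicOpen b))
    (fun x => app_res (projLeft f k) hW x) _
    (diffSec_pow_bijective f k hU a ha)
  simp only [map_pow] at this
  rw [← diffSec_res]
  exact this

end Neighbourhood

/-! ### Coordinates on the projective line -/

section AwayCoordinate

open HomogeneousLocalization

/-- Homogeneity of values: scaling the arguments by `b` scales the value by `b ^ n`. -/
theorem aeval_mul_of_isHomogeneous {F B : Type*} [Field F] [CommRing B] [Algebra F B] {n : ℕ}
    {a : MvPolynomial (Fin 2) F} (ha : a.IsHomogeneous n) (b : B) (y : Fin 2 → B) :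
    MvPolynomial.aeval (fun i => b * y i) a = b ^ n * MvPolynomial.aeval y a := by
  simp only [MvPolynomial.aeval_def, MvPolynomial.eval₂_eq', Finset.mul_sum]
  refine Finset.sum_congr rfl fun d hd => ?_
  have hn : ∑ i, d i = n := by
    have := ha (MvPolynomial.mem_support_iff.mp hd)
    rwa [show (Finsupp.weight 1 d : ℕ) = Finsupp.degree d from
      (DFunLike.congr_fun Finsupp.degree_eq_weight_one d).symm, Finsupp.degree_eq_sum] at this
  simp only [mul_pow, Finset.prod_mul_distrib, Finset.prod_pow_eq_pow_sum, hn]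
  ring

variable (F : Type u) [Field F]

/-- The constants in the degree zero part of `F[x₀, x₁]` localized at `xᵢ`. -/
def awayConst (i : Fin 2) : F →+* Away (gr F) (MvPolynomial.X i : MvPolynomial (Fin 2) F) :=
  (fromZeroRingHom (gr F) _).comp (algebraMap F (gr F 0))

/-- The quotient `xⱼ / xᵢ`. -/
def awayQuot (i j : Fin 2) : Away (gr F) (MvPolynomial.X i : MvPolynomial (Fin 2) F) :=
  Away.mk (gr F) (X_mem F i) 1 (MvPolynomial.X j) (by simpa using X_mem F j)

open Polynomial in
/-- The degree zero part of `F[x₀, x₁]` localized at `xᵢ` is the polynomial ring in `xⱼ / xᵢ`. The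
inverse is the dehomogenization `xᵢ ↦ 1`. -/
theorem eval₂_awayQuot_bijective {i j : Fin 2} (hij : i ≠ j) :
    Function.Bijective (eval₂RingHom (awayConst F i) (awayQuot F i j)) := by
  let y : Fin 2 → F[X] := fun m => if m = i then 1 else X
  let L := Localization.Away (MvPolynomial.X i : MvPolynomial (Fin 2) F)
  have hyi : IsUnit ((MvPolynomial.aeval y).toRingHom
      (MvPolynomial.X i : MvPolynomial (Fin 2) F)) := by
    simp [y]
  -- The dehomogenization, on the whole localization.
  let τ : L →+* F[X] := IsLocalization.Away.lift (MvPolynomial.X i) hyi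
  have hτ : ∀ a, τ (algebraMap _ L a) = MvPolynomial.aeval y a := fun a =>
    IsLocalization.Away.lift_eq _ hyi a
  let val : Away (gr F) (MvPolynomial.X i : MvPolynomial (Fin 2) F) →+* L :=
    algebraMap (Away (gr F) (MvPolynomial.X i : MvPolynomial (Fin 2) F)) L
  have hval : Function.Injective val := HomogeneousLocalization.val_injective _
  have hvc : ∀ c, val (awayConst F i c) = algebraMap _ L (MvPolynomial.C c) := fun c => by
    change Localization.mk _ _ = _
    rw [← Localization.mk_one_eq_algebraMap]
    rfl
  have hvq : ∀ m, val (awayQuot F i m) * algebraMap _ L (MvPolynomial.X i) =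
      algebraMap _ L (MvPolynomial.X m) := fun m => by
    change Localization.mk _ _ * _ = _
    rw [← Localization.mk_one_eq_algebraMap, ← Localization.mk_one_eq_algebraMap,
      Localization.mk_mul, Localization.mk_eq_mk_iff, Localization.r_iff_exists]
    exact ⟨1, by simp [mul_comm]⟩
  have hX : IsUnit (algebraMap _ L (MvPolynomial.X i : MvPolynomial (Fin 2) F)) :=
    IsLocalization.Away.algebraMap_isUnit _
  have hvqi : val (awayQuot F i i) = 1 :=
    hX.mul_left_injective ((hvq i).trans (one_mul _).symm)
  have hvqτ : ∀ m, τ (val (awayQuot F i m)) = y m := fun m => by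
    have := congrArg τ (hvq m)
    rw [map_mul, hτ, hτ, MvPolynomial.aeval_X, MvPolynomial.aeval_X] at this
    simpa [y] using this
  have hleft : ∀ p, τ (val (eval₂RingHom (awayConst F i) (awayQuot F i j) p)) = p := by
    intro p
    have : (τ.comp val).comp (eval₂RingHom (awayConst F i) (awayQuot F i j)) = RingHom.id _ := by
      apply Polynomial.ringHom_ext
      · intro c
        simp [hvc, hτ]
      · simp [hvqτ, y, hij.symm]
    exact RingHom.congr_fun this p
  refine ⟨Function.LeftInverse.injective (g := fun z => τ (val z)) hleft, fun z => ?_⟩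
  -- An element `a / xᵢ ^ n` is the value of the form `a` at the quotients `xₘ / xᵢ`.
  obtain ⟨n, a, ha, rfl⟩ := Away.mk_surjective (gr F) (X_mem F i) z
  refine ⟨MvPolynomial.aeval y a, hval ((hX.pow n).mul_left_injective ?_)⟩
  have ha' : a.IsHomogeneous n := by simpa using ha
  have h1 : val (Away.mk (gr F) (X_mem F i) n a ha) *
      algebraMap (MvPolynomial (Fin 2) F) L (MvPolynomial.X i) ^ n = algebraMap _ L a := by
    change Localization.mk _ _ * _ = _
    rw [← map_pow, ← Localization.mk_one_eq_algebraMap, ← Localization.mk_one_eq_algebraMap,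
      Localization.mk_mul, Localization.mk_eq_mk_iff, Localization.r_iff_exists]
    exact ⟨1, by simp [mul_comm]⟩
  let _ : Algebra F L := ((algebraMap (MvPolynomial (Fin 2) F) L).comp MvPolynomial.C).toAlgebra
  have h2 : MvPolynomial.aeval (R := F)
      (fun m => algebraMap (MvPolynomial (Fin 2) F) L (MvPolynomial.X m)) a =
      algebraMap _ L a := by
    have : (MvPolynomial.aeval (R := F)
        (fun m => algebraMap (MvPolynomial (Fin 2) F) L (MvPolynomial.X m))).toRingHom =
        algebraMap (MvPolynomial (Fin 2) F) L := by
      apply MvPolynomial.ringHom_ext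
      · intro c
        simp
        rfl
      · intro m
        simp [MvPolynomial.aeval_def]
    exact RingHom.congr_fun this a
  have h3 : MvPolynomial.aeval (fun m => val (awayQuot F i m)) a =
      val (eval₂RingHom (awayConst F i) (awayQuot F i j) (MvPolynomial.aeval y a)) := by
    have : (MvPolynomial.aeval (R := F) (fun m => val (awayQuot F i m))).toRingHom =
        (val.comp (eval₂RingHom (awayConst F i) (awayQuot F i j))).comp
          (MvPolynomial.aeval (R := F) y).toRingHom := by
      apply MvPolynomial.ringHom_ext
      · intro c
        simp [hvc]
        rfl
      · intro m
        by_cases hm : m = i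
        · subst hm
          simp [y, MvPolynomial.aeval_def, hvqi]
        · have : m = j := by omega
          subst this
          simp [y, MvPolynomial.aeval_def, hm]
    exact RingHom.congr_fun this a
  simp only
  rw [h1, ← h2, ← h3, mul_comm, ← aeval_mul_of_isHomogeneous ha']
  congr 2
  funext m
  rw [mul_comm, hvq]

end AwayCoordinate

section ProjCoordinate

variable (F : Type u) [Field F]

theorem opens_ι_toSpec (i : Fin 2) :
    (Proj.basicOpen (gr F) (MvPolynomial.X i)).ι ≫ P1.toSpec F =
      (Proj.basicOpen (gr F) (MvPolynomial.X i)).toSpecΓ ≫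
        Spec.map (CommRingCat.ofHom (awayConst F i) ≫
          Proj.awayToSection (gr F) (MvPolynomial.X i)) := by
  have h := Proj.awayι_toSpecZero (gr F) (MvPolynomial.X i) (X_mem F i) one_pos
  rw [Proj.awayι, Category.assoc, Iso.inv_comp_eq, Proj.basicOpenIsoSpec_hom] at h
  rw [P1.toSpec, reassoc_of% h, Proj.basicOpenToSpec, Category.assoc, ← Spec.map_comp,
    ← Spec.map_comp]
  rfl

/-- The constants defined by the structure morphism agree with the constants of the graded ring. -/
theorem const_basicOpen (i : Fin 2) : const F (Proj.basicOpen (gr F) (MvPolynomial.X i)) =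
    (Proj.awayToSection (gr F) (MvPolynomial.X i)).hom.comp (awayConst F i) := by
  have h := congrArg Scheme.Hom.appTop (opens_ι_toSpec F i)
  rw [Scheme.Hom.comp_appTop, Scheme.Hom.comp_appTop, Scheme.Opens.toSpecΓ_appTop,
    Scheme.ΓSpecIso_naturality_assoc, ← Iso.inv_comp_eq, ← Category.assoc,
    Iso.eq_comp_inv, Category.assoc, Category.assoc] at h
  have h' : (Proj.basicOpen (gr F) (MvPolynomial.X i)).ι.appTop ≫
      (Proj.basicOpen (gr F) (MvPolynomial.X i)).topIso.hom =
      (P1 F).presheaf.map (homOfLE le_top).op := by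
    rw [Scheme.Opens.ι_appTop, Scheme.Opens.topIso_hom]
    exact ((P1 F).presheaf.map_comp _ _).symm
  rw [h'] at h
  exact congrArg CommRingCat.Hom.hom h

open Polynomial in
/-- The quotient `xⱼ / xᵢ` is a coordinate on `D(xᵢ)`. -/
theorem eval₂_basicOpen_bijective {i j : Fin 2} (hij : i ≠ j) :
    Function.Bijective (eval₂RingHom
      ((P1.toSpec F).appLE ⊤ (Proj.basicOpen (gr F) (MvPolynomial.X i)) le_top).hom
      ((Proj.awayToSection (gr F) (MvPolynomial.X i)).hom (awayQuot F i j))) := by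
  have hσ : Function.Bijective (Scheme.ΓSpecIso (CommRingCat.of F)).inv.hom :=
    ConcreteCategory.bijective_of_isIso _
  have hw : Function.Bijective (Proj.awayToSection (gr F) (MvPolynomial.X i)).hom := by
    have : IsIso (Proj.awayToSection (gr F) (MvPolynomial.X i)) := by
      rw [← Proj.basicOpenIsoAway_hom (gr F) (MvPolynomial.X i) (X_mem F i) one_pos]
      infer_instance
    exact ConcreteCategory.bijective_of_isIso (Proj.awayToSection (gr F) (MvPolynomial.X i))
  have e : (eval₂RingHom
      ((P1.toSpec F).appLE ⊤ (Proj.basicOpen (gr F) (MvPolynomial.X i)) le_top).hom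
      ((Proj.awayToSection (gr F) (MvPolynomial.X i)).hom (awayQuot F i j))).comp
        (mapRingHom (Scheme.ΓSpecIso (CommRingCat.of F)).inv.hom) =
      (Proj.awayToSection (gr F) (MvPolynomial.X i)).hom.comp
        (eval₂RingHom (awayConst F i) (awayQuot F i j)) := by
    apply Polynomial.ringHom_ext
    · intro c
      have := RingHom.congr_fun (const_basicOpen F i) c
      simp only [RingHom.comp_apply, coe_mapRingHom, map_C, coe_eval₂RingHom, eval₂_C] at this ⊢
      exact this
    · simp
  have h := hw.comp (eval₂_awayQuot_bijective F hij)
  rw [← RingHom.coe_comp, ← e, RingHom.coe_comp] at h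
  exact (Function.Bijective.of_comp_iff _
    ⟨map_injective _ hσ.1, map_surjective _ hσ.2⟩).mp h

theorem eval₂_t_bijective : Function.Bijective
    (Polynomial.eval₂RingHom ((P1.toSpec F).appLE ⊤ (U0 F) le_top).hom (t F)) :=
  eval₂_basicOpen_bijective F zero_ne_one

theorem eval₂_s_bijective : Function.Bijective
    (Polynomial.eval₂RingHom ((P1.toSpec F).appLE ⊤ (U1 F) le_top).hom (s F)) :=
  eval₂_basicOpen_bijective F one_ne_zero

theorem isAffineOpen_U0 : IsAffineOpen (U0 F) :=
  Proj.isAffineOpen_basicOpen (gr F) _ (X_mem F 0) one_pos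

theorem isAffineOpen_U1 : IsAffineOpen (U1 F) :=
  Proj.isAffineOpen_basicOpen (gr F) _ (X_mem F 1) one_pos

theorem U0_sup_U1 : U0 F ⊔ U1 F = ⊤ := by
  rw [← Proj.iSup_basicOpen_eq_top' (gr F) (fun i : Fin 2 => MvPolynomial.X i)
    (fun i => ⟨1, X_mem F i⟩)]
  · refine le_antisymm (sup_le ?_ ?_) (iSup_le fun i => ?_)
    · exact le_iSup (fun i : Fin 2 => Proj.basicOpen (gr F) (MvPolynomial.X i)) 0
    · exact le_iSup (fun i : Fin 2 => Proj.basicOpen (gr F) (MvPolynomial.X i)) 1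
    · fin_cases i
      · exact le_sup_left
      · exact le_sup_right
  · refine eq_top_iff.mpr fun p _ => ?_
    induction p using MvPolynomial.induction_on with
    | C c => exact Subalgebra.algebraMap_mem _ (algebraMap F (gr F 0) c)
    | add p q hp hq => exact add_mem (hp trivial) (hq trivial)
    | mul_X p i hp => exact mul_mem (hp trivial) (Algebra.subset_adjoin ⟨i, rfl⟩)

theorem nontrivial_basicOpen {i j : Fin 2} (hij : i ≠ j) :
    Nontrivial Γ(P1 F, Proj.basicOpen (gr F) (MvPolynomial.X i)) := by
  have : Nontrivial Γ(Spec (CommRingCat.of F), ⊤) :=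
    (ConcreteCategory.bijective_of_isIso
      (Scheme.ΓSpecIso (CommRingCat.of F)).inv).1.nontrivial
  exact (eval₂_basicOpen_bijective F hij).1.nontrivial

end ProjCoordinate

/-! ### Bases of the modules of principal parts -/

section PrincipalPartsBasis

variable {X S : Scheme.{u}} (f : X ⟶ S) [IsSeparated f] (k : ℕ)

theorem rightSec_mres {U V : X.Opens} (h : U ≤ V) (E : X.Modules) (e : Γ(E, V)) :
    mres ((Scheme.Modules.pullback (projRight f k)).obj E) (projLeft_preimage_mono f k h)
      (rightSec f k E e) = rightSec f k E (mres E h e) := by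
  change mres _ _ (mres _ _ (pullSec (projRight f k) E e)) =
    mres _ _ (pullSec (projRight f k) E (mres E h e))
  rw [pullSec_mres, mres_mres, mres_mres]

theorem rightSec_smul {U : X.Opens} (E : X.Modules) (r : Γ(X, U)) (e : Γ(E, U)) :
    rightSec f k E (r • e) = res (projLeft_preimage_le f k U) (((projRight f k).app U).hom r) •
      rightSec f k E e := by
  change mres _ _ (pullSec (projRight f k) E _) = _ • mres _ _ (pullSec (projRight f k) E _)
  rw [pullSec_smul, mres_smul]

theorem smul_diffPowTensor {U : X.Opens} (E : X.Modules) (r : Γ(X, U)) (l : ℕ) (a : Γ(X, U))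
    (e : Γ(E, U)) : r • diffPowTensor f k E l a e =
      ((((projLeft f k).app U).hom r * diffSec f k a ^ l) • rightSec f k E e :) :=
  (smul_smul (((projLeft f k).app U).hom r) (diffSec f k a ^ l) (rightSec f k E e))

theorem diffPowTensor_mres {U V : X.Opens} (h : U ≤ V) (E : X.Modules) (l : ℕ) (a : Γ(X, V))
    (e : Γ(E, V)) : mres (principalParts f k E) h (diffPowTensor f k E l a e) =
      diffPowTensor f k E l (res h a) (mres E h e) := by
  change mres ((Scheme.Modules.pullback (projRight f k)).obj E) (projLeft_preimage_mono f k h)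
    (diffSec f k a ^ l • rightSec f k E e) = diffSec f k _ ^ l • rightSec f k E _
  rw [mres_smul, map_pow, diffSec_res, rightSec_mres]

theorem sum_smul_diffPowTensor {U : X.Opens} (E : X.Modules) {ι : Type*} (I : Finset ι)
    (r : ι → Γ(X, U)) (l : ι → ℕ) (a : Γ(X, U)) (e : Γ(E, U)) :
    ∑ i ∈ I, r i • diffPowTensor f k E (l i) a e =
      ((∑ i ∈ I, ((projLeft f k).app U).hom (r i) * diffSec f k a ^ (l i)) •
        rightSec f k E e :) := by
  rw [Finset.sum_smul]
  exact Finset.sum_congr rfl fun i _ => smul_diffPowTensor f k E (r i) (l i) a e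

/-- If `E` is free on `e` over the affine open set `U` with the coordinate `a`, then the principal
parts of `E` are free on the `(da) ^ l ⊗ e` over the basic open subsets of `U`. -/
theorem diffPowTensor_bijective [IsAffine S] {U : X.Opens} (hU : IsAffineOpen U) (a : Γ(X, U))
    (ha : Function.Bijective (Polynomial.eval₂RingHom (f.appLE ⊤ U le_top).hom a))
    (E : X.Modules) (e : Γ(E, U))
    (he : ∀ (W : (infNhd f k).Opens) (hW : W ≤ projRight f k ⁻¹ᵁ U),
      Function.Bijective fun r : Γ(infNhd f k, W) =>
        r • mres ((Scheme.Modules.pullback (projRight f k)).obj E) hW (pullSec _ E e))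
    {W : X.Opens} (b : Γ(X, U)) (hb : W = X.basicOpen b) (hW : W ≤ U) :
    Function.Bijective fun v : Fin (k + 1) → Γ(X, W) =>
      ∑ l : Fin (k + 1), v l • mres (principalParts f k E) hW (diffPowTensor f k E l a e) := by
  have h := (he _ ((projLeft_preimage_mono f k hW).trans (projLeft_preimage_le f k U))).comp
    (diffSec_pow_bijective_basicOpen f k hU a ha b hb hW)
  refine (congrArg (Function.Bijective (α := Fin (k + 1) → Γ(X, W))
    (β := Γ(principalParts f k E, W))) (funext fun v => ?_)).mpr h
  simp only [diffPowTensor_mres]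
  rw [sum_smul_diffPowTensor, ← rightSec_mres]
  change _ • mres _ _ (mres _ _ (pullSec (projRight f k) E e)) = _
  rw [mres_mres]
  rfl

end PrincipalPartsBasis

/-! ### Morphisms from a direct sum given by an invertible matrix -/

section Desc

/-- An invertible matrix takes a basis to a basis; its columns contain the coefficients. -/
theorem bijective_sum_smul_of_isUnit {A N : Type*} [CommRing A] [AddCommGroup N] [Module A N]
    {m : ℕ} {d e : Fin m → N} (hd : Function.Bijective fun v : Fin m → A => ∑ l, v l • d l)
    {M : Matrix (Fin m) (Fin m) A} (hM : IsUnit M) (he : ∀ r, e r = ∑ l, M l r • d l) :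
    Function.Bijective fun v : Fin m → A => ∑ r, v r • e r := by
  have h := hd.comp (⟨Matrix.mulVec_injective_of_isUnit hM,
    Matrix.mulVec_surjective_iff_isUnit.mpr hM⟩ : Function.Bijective M.mulVec)
  convert h using 1
  funext v
  simp only [he, Function.comp, Matrix.mulVec, dotProduct, Finset.smul_sum, Finset.sum_smul,
    smul_smul]
  rw [Finset.sum_comm]
  simp only [mul_comm]

variable {X : Scheme.{u}} {L N : X.Modules} {m : ℕ}

/-- Evaluation of morphisms at a section. -/
def evalSec (L N : X.Modules) {W : X.Opens} (x : Γ(L, W)) : (L ⟶ N) →+ Γ(N, W) where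
  toFun φ := (φ.app W).hom x
  map_zero' := rfl
  map_add' _ _ := rfl

/-- If `L` is free on `x` over `W`, then a family of morphisms from `L` whose values at `x` form a
basis of `N` over `W` induces a bijection on sections over `W`. -/
theorem biproduct_desc_bijective (φ : Fin m → (L ⟶ N)) {W : X.Opens} (x : Γ(L, W))
    (hx : Function.Bijective fun r : Γ(X, W) => r • x)
    (hφ : Function.Bijective fun v : Fin m → Γ(X, W) => ∑ r, v r • ((φ r).app W).hom x) :
    Function.Bijective ((biproduct.desc φ : (⨁ fun _ : Fin m => L) ⟶ N).app W).hom := by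
  -- Sections of the direct sum are families of multiples of `x`; the direct sum is only used
  -- through its inclusions and projections.
  let i : (Fin m → Γ(X, W)) → Γ(⨁ fun _ : Fin m => L, W) := fun v =>
    ∑ r, ((biproduct.ι (fun _ : Fin m => L) r).app W).hom (v r • x)
  have hi : ∀ v, ((biproduct.desc φ).app W).hom (i v) = ∑ r, v r • ((φ r).app W).hom x := by
    intro v
    simp only [i, map_sum]
    refine Finset.sum_congr rfl fun r _ => ?_
    have := congrArg (evalSec L N (v r • x)) (biproduct.ι_desc φ r)
    refine Eq.trans this ?_
    exact app_smul (φ r) (v r) x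
  have hsurj : Function.Surjective i := by
    intro z
    choose v hv using fun r => hx.2 (((biproduct.π (fun _ : Fin m => L) r).app W).hom z)
    refine ⟨v, ?_⟩
    have := congrArg (evalSec _ _ z) (biproduct.total (f := fun _ : Fin m => L))
    rw [map_sum] at this
    refine Eq.trans ?_ this
    refine Finset.sum_congr rfl fun r _ => ?_
    exact congrArg ((biproduct.ι (fun _ : Fin m => L) r).app W).hom (hv r)
  have hcomp : Function.Bijective (((biproduct.desc φ).app W).hom ∘ i) := by
    convert hφ using 1
    funext v
    exact hi v
  have hib : Function.Bijective i := ⟨hcomp.1.of_comp, hsurj⟩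
  exact (Function.Bijective.of_comp_iff _ hib).mp hcomp

end Desc

/-! ### Generators of the twists and of their principal parts -/

section Twist

variable (F : Type u) [Field F]

theorem t_pow_mul_s_pow (m : ℕ) : (res inf_le_left (t F) ^ m : Γ(P1 F, U0 F ⊓ U1 F)) *
    res inf_le_right (s F) ^ m = 1 := by
  rw [← mul_pow, t_mul_s, one_pow]

theorem x0Pow_eq_glueGen₀ (m : ℕ) : x0Pow F m = glueGen₀ (t_pow_mul_s_pow F m) := rfl

theorem x1Pow_eq_glueGen₁ (m : ℕ) : x1Pow F m = glueGen₁ (res inf_le_left (t F) ^ m) := by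
  apply glueSec_ext
  · change res _ _ ^ m = res _ (res _ _ ^ m)
    rw [map_pow, res_res]
  · rfl

/-- `x₁ ^ m = t ^ m x₀ ^ m` on `U₀ ∩ U₁`. -/
theorem mres_x1Pow (m : ℕ) : mres (twist F m) inf_le_right (x1Pow F m) =
    (res inf_le_left (t F) ^ m : Γ(P1 F, U0 F ⊓ U1 F)) •
      mres (twist F m) inf_le_left (x0Pow F m) := by
  rw [x1Pow_eq_glueGen₁, x0Pow_eq_glueGen₀]
  exact mres_glueGen₁_eq (t_pow_mul_s_pow F m)

theorem x0Pow_smul_bijective (m : ℕ) {W : (P1 F).Opens} (hW : W ≤ U0 F) :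
    Function.Bijective fun r : Γ(P1 F, W) => r • mres (twist F m) hW (x0Pow F m) :=
  ⟨glueGen₀_smul_injective (t_pow_mul_s_pow F m) hW,
    fun a => ⟨_, (glueSec_eq_smul₀ (t_pow_mul_s_pow F m) hW a).symm⟩⟩

theorem x1Pow_smul_bijective (m : ℕ) {W : (P1 F).Opens} (hW : W ≤ U1 F) :
    Function.Bijective fun r : Γ(P1 F, W) => r • mres (twist F m) hW (x1Pow F m) := by
  rw [x1Pow_eq_glueGen₁]
  exact ⟨glueGen₁_smul_injective hW, fun a => ⟨_, (glueSec_eq_smul₁ hW a).symm⟩⟩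

theorem dtPow_bijective (k n : ℕ) {W : (P1 F).Opens} (b : Γ(P1 F, U0 F))
    (hb : W = (P1 F).basicOpen b) (hW : W ≤ U0 F) :
    Function.Bijective fun v : Fin (k + 1) → Γ(P1 F, W) =>
      ∑ l : Fin (k + 1), v l • mres (prin F k n) hW (dtPow F k n l) :=
  diffPowTensor_bijective (P1.toSpec F) k (isAffineOpen_U0 F) (t F) (eval₂_t_bijective F)
    (twist F n) (x0Pow F n)
    (fun _ hW => pullSec_glueGen₀_smul_bijective _ (t_pow_mul_s_pow F n) (U0_sup_U1 F) hW) b hb hW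

theorem dsPow_bijective (k n : ℕ) {W : (P1 F).Opens} (b : Γ(P1 F, U1 F))
    (hb : W = (P1 F).basicOpen b) (hW : W ≤ U1 F) :
    Function.Bijective fun v : Fin (k + 1) → Γ(P1 F, W) =>
      ∑ l : Fin (k + 1), v l • mres (prin F k n) hW (dsPow F k n l) :=
  diffPowTensor_bijective (P1.toSpec F) k (isAffineOpen_U1 F) (s F) (eval₂_s_bijective F)
    (twist F n) (x1Pow F n)
    (fun _ hW => by
      rw [x1Pow_eq_glueGen₁]
      exact pullSec_glueGen₁_smul_bijective _ (t_pow_mul_s_pow F n) (U0_sup_U1 F) hW) b hb hW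

theorem res_const {U V : (P1 F).Opens} (h : U ≤ V) (c : F) :
    res h (const F V c) = const F U c :=
  res_res h le_top _

end Twist

/-! ### The maps given by solutions of the linear systems -/

section MapExists

variable (F : Type u) [Field F]

/-- The maps `φ_r` exist and are unique. Only the equations of `A_r x = b_r` with right hand side
`0` are used, and for `r = 0` there are none of these. -/
theorem exists_isMapOf {n k r : ℕ} (hkn : k ≤ n) (hrk : r ≤ k) (x : Fin (r + 1) → F)
    (hx : ∀ l, k - r < l → l ≤ k → diffCoeff n x l = 0) :
    ∃ φ : twist F (n - k) ⟶ prin F k n, IsMapOf F n k r x φ ∧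
      ∀ ψ, IsMapOf F n k r x ψ → ψ = φ := by
  let e₀ : Γ(prin F k n, U0 F) := ∑ l ∈ Finset.range (k - r + 1),
    (const F (U0 F) (∑ j : Fin (r + 1), (coeff n j l : F) * x j) * t F ^ (k - r - l)) •
      dtPow F k n l
  let e₁ : Γ(prin F k n, U1 F) := ∑ j : Fin (r + 1),
    (const F (U1 F) (x j) * s F ^ (r - (j : ℕ))) • dsPow F k n j
  let V := U0 F ⊓ U1 F
  let t' : Γ(P1 F, V) := res inf_le_left (t F)
  let s' : Γ(P1 F, V) := res inf_le_right (s F)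
  let p := projLeft (P1.toSpec F) k
  let q := projRight (P1.toSpec F) k
  let y : Γ(twist F n, V) := mres (twist F n) inf_le_left (x0Pow F n)
  have hT : (p.app V).hom t' * (p.app V).hom s' = 1 := by
    rw [← map_mul, t_mul_s, map_one]
  have hT' : res (projLeft_preimage_le (P1.toSpec F) k V) ((q.app V).hom t') *
      res (projLeft_preimage_le (P1.toSpec F) k V) ((q.app V).hom s') = 1 := by
    rw [← map_mul, ← map_mul, t_mul_s, map_one, map_one]
  have hD : (res (projLeft_preimage_le (P1.toSpec F) k V) ((q.app V).hom t') -
      (p.app V).hom t') ^ (k + 1) = 0 := by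
    change diffSec (P1.toSpec F) k t' ^ (k + 1) = 0
    rw [← diffSec_res, ← map_pow, diffSec_pow_eq_zero _ _ (isAffineOpen_U0 F), map_zero]
  -- In the coordinates of the infinitesimal neighbourhood over `U₀ ∩ U₁`, where `1 ⊗ x₀ ^ n`
  -- generates, the compatibility of `e₀` and `e₁` is the identity `key`.
  have key := sum_change_of_coordinates ((p.app V).hom.comp (const F V)) hT hT' hkn hrk hD x hx
  have h₀ : mres (prin F k n) inf_le_left e₀ = ((∑ l ∈ Finset.range (k - r + 1),
      (p.app V).hom (const F V (∑ j : Fin (r + 1), (coeff n j l : F) * x j) * t' ^ (k - r - l)) *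
        diffSec (P1.toSpec F) k t' ^ l) • rightSec (P1.toSpec F) k (twist F n) y :) := by
    rw [← sum_smul_diffPowTensor, map_sum]
    refine Finset.sum_congr rfl fun l _ => ?_
    rw [mres_smul, map_mul, map_pow, res_const]
    exact congrArg _ (diffPowTensor_mres _ k inf_le_left (twist F n) l (t F) (x0Pow F n))
  have h₁ : mres (prin F k n) inf_le_right e₁ = ((∑ j : Fin (r + 1),
      (p.app V).hom (const F V (x j) * s' ^ (r - (j : ℕ))) *
        diffSec (P1.toSpec F) k s' ^ (j : ℕ)) •
          rightSec (P1.toSpec F) k (twist F n) (t' ^ n • y) :) := by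
    rw [← sum_smul_diffPowTensor, map_sum, ← mres_x1Pow]
    refine Finset.sum_congr rfl fun j _ => ?_
    rw [mres_smul, map_mul, map_pow, res_const]
    exact congrArg _ (diffPowTensor_mres _ k inf_le_right (twist F n) j (s F) (x1Pow F n))
  have he : mres (prin F k n) inf_le_right e₁ =
      t' ^ (n - k) • mres (prin F k n) (inf_le_left : V ≤ U0 F) e₀ := by
    rw [h₁, h₀, rightSec_smul]
    change _ = (p.app V).hom (t' ^ (n - k)) • (_ • rightSec (P1.toSpec F) k (twist F n) y)
    rw [smul_smul, smul_smul]
    congr 1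
    simp only [map_pow, map_mul]
    rw [Finset.sum_mul]
    simp only [mul_assoc] at key ⊢
    exact key
  obtain ⟨φ, hφ₀, hφ₁⟩ := exists_glueModule_hom (t_pow_mul_s_pow F (n - k)) (U0_sup_U1 F) e₀ e₁ he
  refine ⟨φ, ⟨hφ₀, ?_⟩, fun ψ hψ => ?_⟩
  · rw [x1Pow_eq_glueGen₁]
    exact hφ₁
  · refine glueModule_hom_ext (t_pow_mul_s_pow F (n - k)) (U0_sup_U1 F) (hψ.1.trans hφ₀.symm) ?_
    have := hψ.2
    rw [x1Pow_eq_glueGen₁] at this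
    exact this.trans hφ₁.symm

/-- Extension of the coefficients of a linear combination by zero. -/
theorem sum_smul_eq_sum_extend {A N : Type*} [Ring A] [AddCommGroup N] [Module A N] {m m' : ℕ}
    (h : m ≤ m') (g : Fin m → A) (d : ℕ → N) :
    ∑ j, g j • d j = ∑ j : Fin m', (if h : (j : ℕ) < m then g ⟨j, h⟩ else 0) • d j := by
  let f : ℕ → N := fun j => (if h : j < m then g ⟨j, h⟩ else 0) • d j
  have e : ∀ j : Fin m, g j • d j = f j := fun j => by simp only [f, dif_pos j.2]
  rw [Finset.sum_congr rfl fun j _ => e j, Fin.sum_univ_eq_sum_range f]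
  refine Eq.trans ?_ (Fin.sum_univ_eq_sum_range f m').symm
  refine Finset.sum_subset (Finset.range_mono h) fun j _ hj => ?_
  rw [Finset.mem_range] at hj
  simp only [f, dif_neg hj, zero_smul]

/-- The coefficient of `dt ^ l ⊗ x₀ ^ n` in `φ(x₀ ^ (n - k))`, extended by zero. -/
def tCoeff (n k r : ℕ) (x : Fin (r + 1) → F) (l : ℕ) : Γ(P1 F, U0 F) :=
  if l < k - r + 1 then const F (U0 F) (diffCoeff n x l) * t F ^ (k - r - l) else 0

/-- The coefficient of `ds ^ j ⊗ x₁ ^ n` in `φ(x₁ ^ (n - k))`, extended by zero. -/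
def sCoeff (r : ℕ) (x : Fin (r + 1) → F) (j : ℕ) : Γ(P1 F, U1 F) :=
  if h : j < r + 1 then const F (U1 F) (x ⟨j, h⟩) * s F ^ (r - j) else 0

variable {F} {n k r : ℕ} {x : Fin (r + 1) → F} {φ : twist F (n - k) ⟶ prin F k n}

theorem IsMapOf.app_x0Pow (hrk : r ≤ k) (hφ : IsMapOf F n k r x φ) :
    (φ.app (U0 F)).hom (x0Pow F (n - k)) =
      ∑ l : Fin (k + 1), tCoeff F n k r x l • dtPow F k n l := by
  rw [hφ.1, Finset.sum_range]
  simp only [← diffCoeff.eq_1]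
  rw [sum_smul_eq_sum_extend (show k - r + 1 ≤ k + 1 by omega) (fun l : Fin (k - r + 1) =>
      const F (U0 F) (diffCoeff n x l) * t F ^ (k - r - (l : ℕ))) (dtPow F k n)]
  rfl

theorem IsMapOf.app_x1Pow (hrk : r ≤ k) (hφ : IsMapOf F n k r x φ) :
    (φ.app (U1 F)).hom (x1Pow F (n - k)) =
      ∑ j : Fin (k + 1), sCoeff F r x j • dsPow F k n j := by
  rw [hφ.2, sum_smul_eq_sum_extend (show r + 1 ≤ k + 1 by omega) (fun j : Fin (r + 1) =>
      const F (U1 F) (x j) * s F ^ (r - (j : ℕ))) (dsPow F k n)]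
  rfl

theorem tCoeff_sub : tCoeff F n k r x (k - r) = const F (U0 F) (diffCoeff n x (k - r)) := by
  rw [tCoeff, if_pos (Nat.lt_succ_self _), Nat.sub_self, pow_zero, mul_one]

theorem sCoeff_self : sCoeff F r x r = const F (U1 F) (x (Fin.last r)) := by
  rw [sCoeff, dif_pos (Nat.lt_succ_self _), Nat.sub_self, pow_zero, mul_one]
  rfl

theorem IsMapOf.ne_zero_of_diffCoeff (hrk : r ≤ k) (hφ : IsMapOf F n k r x φ)
    (h : diffCoeff n x (k - r) ≠ 0) : φ ≠ 0 := by
  rintro rfl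
  have e := hφ.app_x0Pow hrk
  have hb := dtPow_bijective F k n 1 (Scheme.basicOpen_of_isUnit _ isUnit_one).symm le_rfl
  have h0 := congrFun (hb.1 (a₁ := 0) (a₂ := fun l => tCoeff F n k r x l) (by
    simp only [mres_self]
    rw [← e]
    simp)) ⟨k - r, by omega⟩
  have : Nontrivial Γ(P1 F, U0 F) := nontrivial_basicOpen F zero_ne_one
  rw [Pi.zero_apply, tCoeff_sub] at h0
  exact (map_ne_zero _).mpr h h0.symm

theorem IsMapOf.ne_zero_of_last (hrk : r ≤ k) (hφ : IsMapOf F n k r x φ)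
    (h : x (Fin.last r) ≠ 0) : φ ≠ 0 := by
  rintro rfl
  have e := hφ.app_x1Pow hrk
  have hb := dsPow_bijective F k n 1 (Scheme.basicOpen_of_isUnit _ isUnit_one).symm le_rfl
  have h0 := congrFun (hb.1 (a₁ := 0) (a₂ := fun j => sCoeff F r x j) (by
    simp only [mres_self]
    rw [← e]
    simp)) ⟨r, by omega⟩
  have : Nontrivial Γ(P1 F, U1 F) := nontrivial_basicOpen F one_ne_zero
  rw [Pi.zero_apply, sCoeff_self] at h0
  exact (map_ne_zero _).mpr h h0.symm

end MapExists

/-! ### The isomorphism -/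

section Iso

theorem isBasis_basicOpen_of_isAffineOpen {X : Scheme.{u}} {V₀ V₁ : X.Opens}
    (h₀ : IsAffineOpen V₀) (h₁ : IsAffineOpen V₁) (hV : V₀ ⊔ V₁ = ⊤) :
    TopologicalSpace.Opens.IsBasis
      (Set.range (X.basicOpen (U := V₀)) ∪ Set.range (X.basicOpen (U := V₁))) := by
  rw [TopologicalSpace.Opens.isBasis_iff_nbhd]
  intro U z hz
  have hz' : z ∈ V₀ ⊔ V₁ := hV ▸ trivial
  rcases hz' with hz' | hz'
  · obtain ⟨b, hb, hzb⟩ := h₀.exists_basicOpen_le ⟨z, hz⟩ hz'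
    exact ⟨_, Or.inl ⟨b, rfl⟩, hzb, hb⟩
  · obtain ⟨b, hb, hzb⟩ := h₁.exists_basicOpen_le ⟨z, hz⟩ hz'
    exact ⟨_, Or.inr ⟨b, rfl⟩, hzb, hb⟩

/-- Let `L` be free on `y` and `N` free on `d` over an open subset `W` of `V`. If the maps `φ r`
send `y` to the combinations of the `d l` with the columns of an invertible matrix as
coefficients, then they induce a bijection from the sections of `L ^ m` over `W`. -/
theorem biproduct_desc_bijective_of_isUnit {X : Scheme.{u}} {L N : X.Modules} {m : ℕ}
    (φ : Fin m → (L ⟶ N)) {V W : X.Opens} (hW : W ≤ V) (y : Γ(L, V)) (d : Fin m → Γ(N, V))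
    (M : Matrix (Fin m) (Fin m) Γ(X, V)) (hM : IsUnit M)
    (hφ : ∀ r, ((φ r).app V).hom y = ∑ l, M l r • d l)
    (hy : Function.Bijective fun r : Γ(X, W) => r • mres L hW y)
    (hd : Function.Bijective fun v : Fin m → Γ(X, W) => ∑ l, v l • mres N hW (d l)) :
    Function.Bijective ((biproduct.desc φ : (⨁ fun _ : Fin m => L) ⟶ N).app W).hom := by
  refine biproduct_desc_bijective φ _ hy (bijective_sum_smul_of_isUnit hd
    (hM.map (res hW).mapMatrix) fun r => ?_)
  rw [← mres_app, hφ, map_sum]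
  exact Finset.sum_congr rfl fun l _ => mres_smul N hW _ _

variable {F : Type u} [Field F] {n k : ℕ} {x : ∀ r : ℕ, Fin (r + 1) → F}

theorem isUnit_tCoeff (h : ∀ i : Fin (k + 1), diffCoeff n (x (k - i)) i ≠ 0) :
    IsUnit (Matrix.of fun l r : Fin (k + 1) => tCoeff F n k r (x r) l) := by
  rw [← Matrix.isUnit_submatrix_equiv (Equiv.refl _) Fin.revPerm,
    isUnit_iff_of_upperTriangular]
  · intro i
    have hi : ((Fin.revPerm i : Fin (k + 1)) : ℕ) = k - i := by simp [Fin.val_rev]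
    have hik : (i : ℕ) = k - (k - i) := by have := i.2; omega
    rw [Matrix.submatrix_apply, Matrix.of_apply, hi, Equiv.refl_apply]
    have e : tCoeff F n k (k - i) (x (k - i)) i =
        const F (U0 F) (diffCoeff n (x (k - i)) i) := by
      have := tCoeff_sub (F := F) (n := n) (k := k) (x := x (k - i))
      rwa [← hik] at this
    rw [e]
    exact (isUnit_iff_ne_zero.mpr (h i)).map _
  · intro l i hil
    have hi : ((Fin.revPerm i : Fin (k + 1)) : ℕ) = k - i := by simp [Fin.val_rev]
    have := Fin.lt_def.mp hil
    have := i.2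
    rw [Matrix.submatrix_apply, Matrix.of_apply, hi, Equiv.refl_apply]
    exact if_neg (by omega)

theorem isUnit_sCoeff (h : ∀ i : Fin (k + 1), x i (Fin.last i) ≠ 0) :
    IsUnit (Matrix.of fun j r : Fin (k + 1) => sCoeff F r (x r) j) := by
  rw [isUnit_iff_of_upperTriangular]
  · intro i
    rw [Matrix.of_apply, sCoeff_self]
    exact (isUnit_iff_ne_zero.mpr (h i)).map _
  · intro j i hij
    exact dif_neg (by have := Fin.lt_def.mp hij; omega)

/-- Over the basic open subsets of `U₀` the matrix of `⨁ φ_r` in the bases given by `x₀ ^ (n - k)`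
and the `dt ^ l ⊗ x₀ ^ n` is triangular after reversing the columns, with the constants `c_{k - r}`
on the diagonal; over those of `U₁` it is triangular with the constants `x_{r, r}` on the
diagonal. -/
theorem isIso_desc {φ : Fin (k + 1) → (twist F (n - k) ⟶ prin F k n)}
    (hφ : ∀ r : Fin (k + 1), IsMapOf F n k r (x r) (φ r))
    (hx : ∀ r : ℕ, 1 ≤ r → r ≤ k → IsSolution F n k r (x r))
    (hprod : ∏ i ∈ Finset.range (k + 1), x i (Fin.last i) ≠ 0) :
    IsIso (biproduct.desc φ : (⨁ fun _ : Fin (k + 1) => twist F (n - k)) ⟶ prin F k n) := by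
  refine isIso_of_bijective_on_basis _ _ (isBasis_basicOpen_of_isAffineOpen (isAffineOpen_U0 F)
    (isAffineOpen_U1 F) (U0_sup_U1 F)) ?_
  rintro _ (⟨b, rfl⟩ | ⟨b, rfl⟩)
  · have hW := (P1 F).basicOpen_le b
    exact biproduct_desc_bijective_of_isUnit φ hW (x0Pow F (n - k)) (fun l => dtPow F k n l) _
      (isUnit_tCoeff (diffCoeff_sub_ne_zero hx hprod))
      (fun r => (hφ r).app_x0Pow (Nat.lt_succ_iff.mp r.2))
      (x0Pow_smul_bijective F (n - k) hW) (dtPow_bijective F k n b rfl hW)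
  · have hW := (P1 F).basicOpen_le b
    exact biproduct_desc_bijective_of_isUnit φ hW (x1Pow F (n - k)) (fun l => dsPow F k n l) _
      (isUnit_sCoeff fun i => Finset.prod_ne_zero_iff.mp hprod i (Finset.mem_range.mpr i.2))
      (fun r => (hφ r).app_x1Pow (Nat.lt_succ_iff.mp r.2))
      (x1Pow_smul_bijective F (n - k) hW) (dsPow_bijective F k n b rfl hW)

end Iso

end PrincipalParts

end

open PrincipalParts in
theorem theorem5p2 (F : Type u) [Field F] (n k : ℕ) (hk : 1 ≤ k) (hkn : k ≤ n) :
    (∀ r : ℕ, 1 ≤ r → r ≤ k → ∀ x : Fin (r + 1) → F, IsSolution F n k r x →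
      ∃ φ : twist F (n - k) ⟶ prin F k n,
        IsMapOf F n k r x φ ∧ φ ≠ 0 ∧ ∀ ψ, IsMapOf F n k r x ψ → ψ = φ) ∧
    (∃ φ : twist F (n - k) ⟶ prin F k n,
      IsMapOf F n k 0 (fun _ => 1) φ ∧ φ ≠ 0 ∧ ∀ ψ, IsMapOf F n k 0 (fun _ => 1) ψ → ψ = φ) ∧
    (∀ x : ∀ r : ℕ, Fin (r + 1) → F, x 0 = (fun _ => 1) →
      (∀ r : ℕ, 1 ≤ r → r ≤ k → IsSolution F n k r (x r)) →
      ∏ i ∈ Finset.range (k + 1), x i (Fin.last i) ≠ 0 →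
      ∃ φ : Fin (k + 1) → (twist F (n - k) ⟶ prin F k n),
        (∀ r : Fin (k + 1), IsMapOf F n k r (x r) (φ r)) ∧
        IsIso (biproduct.desc φ : (⨁ fun _ : Fin (k + 1) => twist F (n - k)) ⟶ prin F k n)) := by
  refine ⟨fun r hr hrk x hx => ?_, ?_, fun x hx0 hx hprod => ?_⟩
  · obtain ⟨φ, hφ, huniq⟩ := exists_isMapOf F hkn hrk x fun l hl hlk => by
      rw [hx.diffCoeff_eq hrk hl.le hlk, if_neg hl.ne']
    refine ⟨φ, hφ, hφ.ne_zero_of_diffCoeff hrk ?_, huniq⟩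
    rw [hx.diffCoeff_eq hrk le_rfl (Nat.sub_le k r), if_pos rfl]
    exact one_ne_zero
  · obtain ⟨φ, hφ, huniq⟩ := exists_isMapOf F hkn (Nat.zero_le k) (fun _ => 1)
      fun l hl hlk => absurd hl (by omega)
    exact ⟨φ, hφ, hφ.ne_zero_of_last (Nat.zero_le k) one_ne_zero, huniq⟩
  · have hex : ∀ r : Fin (k + 1), ∃ φ, IsMapOf F n k r (x r) φ := fun r => by
      have hrk := Nat.lt_succ_iff.mp r.2
      obtain ⟨φ, hφ, -⟩ := exists_isMapOf F hkn hrk (x r) fun l hl hlk => by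
        have hr : 1 ≤ (r : ℕ) := by omega
        rw [(hx r hr hrk).diffCoeff_eq hrk hl.le hlk, if_neg hl.ne']
      exact ⟨φ, hφ⟩
    choose φ hφ using hex
    exact ⟨φ, hφ, isIso_desc hφ hx hprod⟩
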